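/- Let $V$ be an $n$-dimensional real vector space with dual $V^*$, let $W = V \times V^*$, and let $K \subset V$ be a centrally symmetric convex body (compact, convex, with non-empty interior, $K = -K$) with polar body $K^\circ = \{y \in V^* : |\langle x, y\rangle| \le 1 \text{ for all } x \in K\}$. Assume that $K$ and $K^\circ$ are both smooth, that is, that $\partial K$ and $\partial K^\circ$ are $C^\infty$ hypersurfaces. Put $$K^{\pm} = \{(x,y) \in K \times K^\circ : \langle x, y\rangle = \pm 1\} \subset W,$$ and let $J = K^+ * K^-$ be the topological join, that is, the quotient of $K^+ \times K^- \times [0,1]$ by the relations $(x,y,0) \sim (x',y,0)$ and $(x,y,1) \sim (x,y',1)$. Let $j : J \to W$ be the map $j(x,y,t) = t x + (1-t) y$, where $x \in K^+$ and $y \in K^-$. 1. The map $j$ is a smooth embedding off a null set: there is a closed set $N \subset J$ of $(2n-1)$-dimensional measure zero that contains all points with $t \in \{0,1\}$, such that $J \setminus N$ is a smooth $(2n-1)$-manifold (as an open subset of $K^+ \times K^- \times (0,1)$, that is, as an embedded submanifold of $W \times W \times \mathbb{R}$) and $j$ restricted to $J \setminus N$ is a smooth embedding (an immersion that is a homeomorphism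 onto its image). 2. The set $j(J)$ meets almost every ray from the origin in $W$ exactly once: for almost every $w \in W \setminus \{0\}$ (with respect to Lebesgue measure on $W$), there is exactly one $s \ge 0$ with $s w \in j(J)$. -/

import Mathlib

open Set Topology MeasureTheory Manifold
open scoped ContDiff

/-- The boundary of `K` is a smooth hypersurface: near each of its points it is the zero set of a
`C^∞` function without critical points. -/
def HasSmoothBoundary {E : Type*} [NormedAddCommGroup E] [NormedSpace ℝ E] (K : Set E) : Prop :=
  ∀ x ∈ frontier K, ∃ (U : Set E) (f : E → ℝ), IsOpen U ∧ x ∈ U ∧ ContDiffOn ℝ ∞ f U ∧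
    (∀ z ∈ U, fderiv ℝ f z ≠ 0) ∧ frontier K ∩ U = {z | z ∈ U ∧ f z = 0}

/-- `K⁺ = {(x, y) ∈ K × K° | ⟨x, y⟩ = 1}`. Mathlib's `StrongDual.polar ℝ K` is
`{y | ∀ x ∈ K, |⟨x, y⟩| ≤ 1}`. -/
def plusPart {V : Type*} [NormedAddCommGroup V] [NormedSpace ℝ V] (K : Set V) :
    Set (V × StrongDual ℝ V) :=
  {w | w.1 ∈ K ∧ w.2 ∈ StrongDual.polar ℝ K ∧ w.2 w.1 = 1}

/-- `K⁻ = {(x, y) ∈ K × K° | ⟨x, y⟩ = -1}`. -/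
def minusPart {V : Type*} [NormedAddCommGroup V] [NormedSpace ℝ V] (K : Set V) :
    Set (V × StrongDual ℝ V) :=
  {w | w.1 ∈ K ∧ w.2 ∈ StrongDual.polar ℝ K ∧ w.2 w.1 = -1}

/-- The identifications that define the topological join: the first factor is collapsed at `t = 0`
and the second one at `t = 1`. -/
inductive JoinRel (X Y : Type*) : X × Y × unitInterval → X × Y × unitInterval → Prop
  | zero (x x' : X) (y : Y) : JoinRel X Y (x, y, 0) (x', y, 0)
  | one (x : X) (y y' : Y) : JoinRel X Y (x, y, 1) (x, y', 1)

/-- The topological join `X * Y`, a quotient of `X × Y × [0, 1]`. -/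
def TopJoin (X Y : Type*) : Type _ := Quot (JoinRel X Y)

namespace TopJoin

/-- The quotient map. -/
def mk {X Y : Type*} (p : X × Y × unitInterval) : TopJoin X Y := Quot.mk _ p

/-- The quotient topology. -/
instance {X Y : Type*} [TopologicalSpace X] [TopologicalSpace Y] :
    TopologicalSpace (TopJoin X Y) :=
  inferInstanceAs (TopologicalSpace (Quot (JoinRel X Y)))

/-- The natural map `[x, y, t] ↦ t x + (1 - t) y` from the join of two subsets of a vector space
to the space. -/
def toSpace {W : Type*} [AddCommGroup W] [Module ℝ W] (A B : Set W) : TopJoin A B → W :=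
  Quot.lift (fun p => (p.2.2 : ℝ) • (p.1 : W) + (1 - (p.2.2 : ℝ)) • (p.2.1 : W)) (by
    rintro _ _ (⟨x, x', y⟩ | ⟨x, y, y'⟩) <;> simp)

/-- The part of `A × B × (0, 1)` (as a subset of `W × W × ℝ`) that corresponds to the complement
of the subset `N` of the join `A * B`. -/
def smoothPart {W : Type*} (A B : Set W) (N : Set (TopJoin A B)) : Set (W × W × ℝ) :=
  {p | ∃ (x : A) (y : B) (t : unitInterval), 0 < t ∧ t < 1 ∧ mk (x, y, t) ∉ N ∧
    p = ((x : W), (y : W), (t : ℝ))}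

/-- Null sets of the join of two metric spaces with respect to `d`-dimensional Hausdorff measure
(on `X × Y × [0, 1]`). If `X` and `Y` are compact `C¹` submanifolds whose dimensions add up to
`d - 1`, then these are the sets that have measure zero in the usual sense. -/
def IsNull {X Y : Type*} [MetricSpace X] [MetricSpace Y] [MeasurableSpace (X × Y × unitInterval)]
    [BorelSpace (X × Y × unitInterval)] (d : ℝ) (N : Set (TopJoin X Y)) : Prop :=
  μH[d] ((mk : X × Y × unitInterval → TopJoin X Y) ⁻¹' N) = 0

end TopJoin

/-- The set `M` is an embedded smooth `m`-dimensional submanifold of `E` and the restriction of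
`f` to it is a smooth embedding. (The smooth structure that makes the inclusion `M → E` a smooth
embedding is unique.) -/
def IsSmoothEmbeddingOn {E F : Type*} [NormedAddCommGroup E] [NormedSpace ℝ E]
    [NormedAddCommGroup F] [NormedSpace ℝ F] (m : ℕ) (M : Set E) (f : E → F) : Prop :=
  ∃ _ : ChartedSpace (EuclideanSpace ℝ (Fin m)) M,
    IsManifold (𝓡 m) ∞ M ∧
    IsSmoothEmbedding (𝓡 m) 𝓘(ℝ, E) ∞ (Subtype.val : M → E) ∧
    IsSmoothEmbedding (𝓡 m) 𝓘(ℝ, F) ∞ (fun p : M => f p)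

/-! Let `g` be the gauge of `K` and `D` the derivative of `g ^ 2 / 2`. Smoothness of `K` makes the
supporting functional at each boundary point unique, so `K⁺` and `K⁻` are the graphs of `D` and `-D`
over the boundary (`mem_plusPart_iff`, `mem_minusPart_iff`). Since `D` is homogeneous of degree one,
`j(x, y, t) = F(t x, (1 - t) y)`, where `F(u, v) = (u + v, D u - D v)` is `sumDiffMap`; here vectors
of `V` stand for the first components of `x` and `y`. Hence `j(J)` is the image under `F` of `{g u +
g v = 1}`.

The map `F` is a homogeneous bijection from `V × V` to `W`. Injectivity comes from strict
monotonicity of `D`, which uses smoothness of the polar; surjectivity comes from minimizing a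
coercive function. So every ray meets `j(J)` exactly once.

The duality map of the polar inverts `D`, so the derivative of `D` away from the origin is positive
definite and the derivative of `F` is invertible wherever `u` and `v` are both nonzero. Therefore
`N` can be taken to be just the two ends of the join. The rest is parametrized by the rays of `V ×
V` with both components nonzero, and stereographic projection turns these rays into an open set of
Euclidean space. Differentiable left inverses then give the embedding. -/

/-- A closed bounded convex symmetric neighbourhood of the origin whose boundary is a smooth
hypersurface. -/
structure IsSmoothBody {E : Type*} [NormedAddCommGroup E] [NormedSpace ℝ E] (C : Set E) :
    Prop where
  convex : Convex ℝ C
  isClosed : IsClosed C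
  isBounded : Bornology.IsBounded C
  mem_nhds : C ∈ 𝓝 (0 : E)
  neg_mem : ∀ x ∈ C, -x ∈ C
  smooth : HasSmoothBoundary C

/-! ### Gauges of smooth bodies. -/

namespace IsSmoothBody

variable {E : Type*} [NormedAddCommGroup E] [NormedSpace ℝ E] {C : Set E}

theorem gauge_pos (hC : IsSmoothBody C) {x : E} (hx : x ≠ 0) : 0 < gauge C x :=
  (_root_.gauge_pos (absorbent_nhds_zero hC.mem_nhds)
    ((NormedSpace.isVonNBounded_iff ℝ).2 hC.isBounded)).2 hx

theorem continuous_gauge (hC : IsSmoothBody C) : Continuous (gauge C) :=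
  _root_.continuous_gauge hC.convex hC.mem_nhds

theorem gauge_le_one_iff (hC : IsSmoothBody C) {x : E} : gauge C x ≤ 1 ↔ x ∈ C := by
  rw [gauge_le_one_iff_mem_closure hC.convex hC.mem_nhds, hC.isClosed.closure_eq]

theorem gauge_eq_one_iff (hC : IsSmoothBody C) {x : E} : gauge C x = 1 ↔ x ∈ frontier C :=
  gauge_eq_one_iff_mem_frontier hC.convex hC.mem_nhds

theorem gauge_add_le (hC : IsSmoothBody C) (x y : E) :
    gauge C (x + y) ≤ gauge C x + gauge C y :=
  _root_.gauge_add_le hC.convex (absorbent_nhds_zero hC.mem_nhds) x y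

theorem gauge_neg (hC : IsSmoothBody C) (x : E) : gauge C (-x) = gauge C x :=
  _root_.gauge_neg hC.neg_mem x

theorem gauge_smul (hC : IsSmoothBody C) (t : ℝ) (x : E) : gauge C (t • x) = |t| * gauge C x := by
  rcases le_total 0 t with h | h
  · rw [gauge_smul_of_nonneg h, abs_of_nonneg h, smul_eq_mul]
  · rw [← hC.gauge_neg, ← neg_smul, gauge_smul_of_nonneg (neg_nonneg.2 h), abs_of_nonpos h,
      smul_eq_mul]

theorem gauge_inv_smul_self (hC : IsSmoothBody C) {x : E} (hx : x ≠ 0) :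
    gauge C ((gauge C x)⁻¹ • x) = 1 := by
  rw [hC.gauge_smul, abs_of_pos (inv_pos.2 (hC.gauge_pos hx)),
    inv_mul_cancel₀ (hC.gauge_pos hx).ne']

/-- The position vector of a boundary point is transversal to the boundary. -/
theorem fderiv_apply_self_ne_zero (hC : IsSmoothBody C) {x : E} (hx : x ∈ frontier C) {U : Set E}
    {f : E → ℝ} (hU : IsOpen U) (hxU : x ∈ U) (hf : DifferentiableOn ℝ f U)
    (hf' : fderiv ℝ f x ≠ 0) (hfU : frontier C ∩ U = {z | z ∈ U ∧ f z = 0}) :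
    fderiv ℝ f x x ≠ 0 := by
  -- If `x` were tangent, then `f` would have opposite signs at `(1 - ε) x + ε k` and `(1 - ε) x - ε
  -- k` for small `ε > 0` and a suitable small `k` transversal to the boundary. A zero between them
  -- is a boundary point, yet convexity puts the whole segment into the interior.
  intro h0
  obtain ⟨h, hh⟩ : ∃ h, fderiv ℝ f x h ≠ 0 := by
    by_contra! H
    exact hf' (ContinuousLinearMap.ext H)
  have hfx : f x = 0 := by
    have : x ∈ frontier C ∩ U := ⟨hx, hxU⟩
    rw [hfU] at this
    exact this.2
  -- a multiple of `h` lies in the interior together with its negative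
  have hev : ∀ᶠ r : ℝ in 𝓝 0, r • h ∈ interior C := by
    have : Filter.Tendsto (fun r : ℝ => r • h) (𝓝 0) (𝓝 0) :=
      Continuous.tendsto' (by fun_prop) _ _ (zero_smul _ _)
    exact this (interior_mem_nhds.2 hC.mem_nhds)
  obtain ⟨δ, hδ, hball⟩ := Metric.eventually_nhds_iff.1 hev
  set k : E := (δ / 2) • h with hk
  have hk0 : fderiv ℝ f x k ≠ 0 := by
    rw [hk, map_smul, smul_eq_mul]
    exact mul_ne_zero (by positivity) hh
  have hkint : ∀ r ∈ Icc (-1 : ℝ) 1, r • k ∈ interior C := by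
    intro r hr
    rw [hk, smul_smul]
    apply hball
    rw [dist_zero_right, Real.norm_eq_abs, abs_mul, abs_of_pos (half_pos hδ)]
    have := abs_le.2 hr
    nlinarith
  have hd : HasFDerivAt f (fderiv ℝ f x) x :=
    (hf.differentiableAt (hU.mem_nhds hxU)).hasFDerivAt
  -- the derivative of `f` along the two curves
  have hcurve : ∀ σ : ℝ, HasDerivAt (fun ε : ℝ => f (x + ε • (σ • k - x)))
      (σ * fderiv ℝ f x k) 0 := by
    intro σ
    have h1 : HasDerivAt (fun ε : ℝ => x + ε • (σ • k - x)) (σ • k - x) 0 := by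
      simpa using ((hasDerivAt_id (0 : ℝ)).smul_const (σ • k - x)).const_add x
    have h2 : HasFDerivAt f (fderiv ℝ f x) (x + (0 : ℝ) • (σ • k - x)) := by simpa using hd
    have h3 : fderiv ℝ f x (σ • k - x) = σ * fderiv ℝ f x k := by simp [h0]
    rw [← h3]
    exact h2.comp_hasDerivAt (0 : ℝ) h1
  have hUev : ∀ᶠ ε : ℝ in 𝓝 0, ∀ r ∈ Icc (-1 : ℝ) 1, x + ε • (r • k - x) ∈ U := by
    have hc : Continuous fun p : ℝ × ℝ => x + p.1 • (p.2 • k - x) := by fun_prop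
    have := isCompact_Icc.eventually_forall_of_forall_eventually (x₀ := (0 : ℝ))
      (K := Icc (-1 : ℝ) 1)
      (P := fun ε r => x + ε • (r • k - x) ∈ U) (fun r _ => by
        have : Filter.Tendsto (fun p : ℝ × ℝ => x + p.1 • (p.2 • k - x)) (𝓝 (0, r)) (𝓝 x) := by
          simpa using hc.tendsto (0, r)
        exact this (hU.mem_nhds hxU))
    exact this
  have hsign : ∀ σ : ℝ, 0 < σ * fderiv ℝ f x k →
      ∀ᶠ ε : ℝ in 𝓝[>] 0, 0 < f (x + ε • (σ • k - x)) := by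
    intro σ hσ
    have := (hasDerivAt_iff_tendsto_slope.1 (hcurve σ)).eventually (lt_mem_nhds hσ)
    have h2 := this.filter_mono (nhdsWithin_mono (0 : ℝ) (fun a (ha : 0 < a) => ha.ne'))
    filter_upwards [h2, self_mem_nhdsWithin] with ε hε hpos
    have hpos : 0 < ε := hpos
    simp only [slope_def_field, zero_smul, add_zero, hfx, sub_zero] at hε
    exact (div_pos_iff_of_pos_right hpos).1 hε
  have hsign' : ∀ σ : ℝ, σ * fderiv ℝ f x k < 0 →
      ∀ᶠ ε : ℝ in 𝓝[>] 0, f (x + ε • (σ • k - x)) < 0 := by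
    intro σ hσ
    have := (hasDerivAt_iff_tendsto_slope.1 (hcurve σ)).eventually (gt_mem_nhds hσ)
    have h2 := this.filter_mono (nhdsWithin_mono (0 : ℝ) (fun a (ha : 0 < a) => ha.ne'))
    filter_upwards [h2, self_mem_nhdsWithin] with ε hε hpos
    have hpos : 0 < ε := hpos
    simp only [slope_def_field, zero_smul, add_zero, hfx, sub_zero] at hε
    exact (div_neg_iff.1 hε).elim (fun h => absurd hpos h.2.not_gt) (fun h => h.1)
  -- by the intermediate value theorem, `f` vanishes at an interior point
  have key : ∀ᶠ ε : ℝ in 𝓝[>] 0, ∃ r ∈ Icc (-1 : ℝ) 1, f (x + ε • (r • k - x)) = 0 := by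
    have hcont : ∀ ε : ℝ, (∀ r ∈ Icc (-1 : ℝ) 1, x + ε • (r • k - x) ∈ U) →
        ContinuousOn (fun r : ℝ => f (x + ε • (r • k - x))) (Icc (-1) 1) := fun ε hε =>
      hf.continuousOn.comp (by fun_prop) hε
    rcases lt_or_gt_of_ne hk0 with hneg | hpos
    · filter_upwards [hsign (-1) (by linarith), hsign' 1 (by linarith),
        hUev.filter_mono nhdsWithin_le_nhds] with ε h1 h2 h3
      have := intermediate_value_Icc' (by norm_num) (hcont ε h3)
      obtain ⟨r, hr, hr0⟩ := this ⟨h2.le, h1.le⟩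
      exact ⟨r, hr, hr0⟩
    · filter_upwards [hsign 1 (by linarith), hsign' (-1) (by linarith),
        hUev.filter_mono nhdsWithin_le_nhds] with ε h1 h2 h3
      have := intermediate_value_Icc (by norm_num) (hcont ε h3)
      obtain ⟨r, hr, hr0⟩ := this ⟨h2.le, h1.le⟩
      exact ⟨r, hr, hr0⟩
  have hlt : ∀ᶠ ε : ℝ in 𝓝[>] 0, ε < 1 :=
    (gt_mem_nhds one_pos).filter_mono nhdsWithin_le_nhds
  obtain ⟨ε, ⟨r, hr, hr0⟩, hε1, hεU, hε0⟩ := (key.and (hlt.and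
    ((hUev.filter_mono nhdsWithin_le_nhds).and self_mem_nhdsWithin))).exists
  have hε0 : 0 < ε := hε0
  have hmem : x + ε • (r • k - x) ∈ interior C := by
    have := hC.convex.combo_closure_interior_mem_interior (frontier_subset_closure hx)
      (hkint r hr) (a := 1 - ε) (b := ε) (by linarith) hε0 (by ring)
    convert this using 1
    module
  have hfr : x + ε • (r • k - x) ∈ frontier C := by
    have : x + ε • (r • k - x) ∈ frontier C ∩ U := by
      rw [hfU]
      exact ⟨hεU r hr, hr0⟩
    exact this.1
  exact hfr.2 hmem

/-- The gauge of a smooth body is smooth away from the origin. -/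
theorem contDiffAt_gauge [CompleteSpace E] (hC : IsSmoothBody C) {x : E} (hx : x ≠ 0) :
    ContDiffAt ℝ ∞ (gauge C) x := by
  have hg := hC.gauge_pos hx
  set z : E := (gauge C x)⁻¹ • x with hz
  have hzC : z ∈ frontier C := hC.gauge_eq_one_iff.1 (hC.gauge_inv_smul_self hx)
  obtain ⟨U, f, hU, hzU, hf, hf', hfU⟩ := hC.smooth z hzC
  have htr := hC.fderiv_apply_self_ne_zero hzC hU hzU (hf.differentiableOn (by simp)) (hf' z hzU)
    hfU
  -- Implicit function theorem: `r = gauge C y` solves `f (r⁻¹ • y) = 0`. The derivative of `H` is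
  -- triangular, and its diagonal entry `c` in the `r` direction is nonzero by transversality.
  set H : E × ℝ → E × ℝ := fun p => (p.1, f (p.2⁻¹ • p.1)) with hH
  have hfz : ContDiffAt ℝ ∞ f z := hf.contDiffAt (hU.mem_nhds hzU)
  have hfd : HasFDerivAt f (fderiv ℝ f z) z := (hfz.differentiableAt (by simp)).hasFDerivAt
  have hHc : ContDiffAt ℝ ∞ H (x, gauge C x) := by
    refine contDiffAt_fst.prodMk ?_
    refine ContDiffAt.comp (x, gauge C x) hfz ?_
    exact (contDiffAt_snd.inv hg.ne').smul contDiffAt_fst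
  set c : ℝ := -(gauge C x)⁻¹ * fderiv ℝ f z z with hc
  have hc0 : c ≠ 0 := mul_ne_zero (neg_ne_zero.2 (inv_ne_zero hg.ne')) htr
  have hinner : HasFDerivAt (fun p : E × ℝ => p.2⁻¹ • p.1)
      ((gauge C x)⁻¹ • ContinuousLinearMap.fst ℝ E ℝ +
        ((-((gauge C x) ^ 2)⁻¹) • ContinuousLinearMap.snd ℝ E ℝ).smulRight x)
      (x, gauge C x) := by
    have h1 : HasFDerivAt (fun p : E × ℝ => p.2⁻¹)
        ((-((gauge C x) ^ 2)⁻¹) • ContinuousLinearMap.snd ℝ E ℝ) (x, gauge C x) :=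
      (hasDerivAt_inv hg.ne').comp_hasFDerivAt (x, gauge C x) hasFDerivAt_snd
    exact h1.smul hasFDerivAt_fst
  set A : E →L[ℝ] ℝ := (gauge C x)⁻¹ • fderiv ℝ f z with hA
  have hsnd : HasFDerivAt (fun p : E × ℝ => f (p.2⁻¹ • p.1))
      (A.comp (ContinuousLinearMap.fst ℝ E ℝ) + c • ContinuousLinearMap.snd ℝ E ℝ)
      (x, gauge C x) := by
    have := HasFDerivAt.comp (x, gauge C x) (g := f) (by exact hfd) hinner
    refine this.congr_fderiv ?_
    ext v
    · simp [hA]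
    · simp only [hc, hz]
      simp
      field_simp
  let L : (E × ℝ) ≃L[ℝ] (E × ℝ) := ContinuousLinearEquiv.equivOfInverse
    ((ContinuousLinearMap.fst ℝ E ℝ).prod
      (A.comp (ContinuousLinearMap.fst ℝ E ℝ) + c • ContinuousLinearMap.snd ℝ E ℝ))
    ((ContinuousLinearMap.fst ℝ E ℝ).prod
      (c⁻¹ • (ContinuousLinearMap.snd ℝ E ℝ - A.comp (ContinuousLinearMap.fst ℝ E ℝ))))
    (by rintro ⟨v, r⟩; ext <;> simp [hc0])
    (by rintro ⟨v, r⟩; ext <;> simp [hc0])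
  have hHd : HasFDerivAt H (L : (E × ℝ) →L[ℝ] (E × ℝ)) (x, gauge C x) :=
    hasFDerivAt_fst.prodMk hsnd
  have hinv := hHc.to_localInverse hHd (by simp)
  have hfz0 : ∀ y : E, y ≠ 0 → (gauge C y)⁻¹ • y ∈ U → H (y, gauge C y) = (y, 0) := by
    intro y hy hyU
    have : (gauge C y)⁻¹ • y ∈ frontier C ∩ U :=
      ⟨hC.gauge_eq_one_iff.1 (hC.gauge_inv_smul_self hy), hyU⟩
    rw [hfU] at this
    exact Prod.ext rfl this.2
  have hH0 : H (x, gauge C x) = (x, 0) := hfz0 x hx hzU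
  rw [hH0] at hinv
  have hgc := hC.continuous_gauge
  have hev := ((hHc.hasStrictFDerivAt' hHd (by simp)).eventually_left_inverse)
  have hpair : Filter.Tendsto (fun y : E => (y, gauge C y)) (𝓝 x) (𝓝 (x, gauge C x)) :=
    (continuous_id.prodMk hgc).tendsto x
  have hUx : ∀ᶠ y in 𝓝 x, (gauge C y)⁻¹ • y ∈ U :=
    ((hgc.continuousAt.inv₀ hg.ne').smul continuousAt_id).eventually (hU.mem_nhds hzU)
  have heq : gauge C =ᶠ[𝓝 x] fun y => (hHc.localInverse hHd (by simp) (y, 0)).2 := by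
    filter_upwards [hpair.eventually hev, hUx, isOpen_ne.mem_nhds hx] with y h1 h2 h3
    rw [← hfz0 y h3 h2]
    exact (congrArg Prod.snd h1).symm
  refine ContDiffAt.congr_of_eventuallyEq ?_ heq
  exact contDiffAt_snd.comp x (hinv.comp x (contDiffAt_id.prodMk contDiffAt_const))

/-- A linear functional that is dominated by the gauge and agrees with it at a point is the
derivative of the gauge at that point. -/
theorem fderiv_gauge_eq [CompleteSpace E] (hC : IsSmoothBody C) {x : E} (hx : x ≠ 0)
    {l : StrongDual ℝ E} (hle : ∀ z, l z ≤ gauge C z) (heq : l x = gauge C x) :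
    fderiv ℝ (gauge C) x = l := by
  have hd := ((hC.contDiffAt_gauge hx).differentiableAt (by simp)).hasFDerivAt
  have hmin : IsLocalMin (fun z => gauge C z - l z) x :=
    Filter.Eventually.of_forall fun z => by
      have := hle z
      show gauge C x - l x ≤ gauge C z - l z
      linarith
  exact sub_eq_zero.1 (hmin.hasFDerivAt_eq_zero (hd.sub l.hasFDerivAt))

/-- Euler's identity for a function that is positively homogeneous of degree one. -/
theorem fderiv_gauge_apply_self [CompleteSpace E] (hC : IsSmoothBody C) {x : E} (hx : x ≠ 0) :
    fderiv ℝ (gauge C) x x = gauge C x := by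
  have hd := ((hC.contDiffAt_gauge hx).differentiableAt (by simp)).hasFDerivAt
  have h1 : HasDerivAt (fun t : ℝ => t • x) x 1 := by
    simpa using (hasDerivAt_id (1 : ℝ)).smul_const x
  have h2 : HasDerivAt (fun t : ℝ => gauge C (t • x)) (fderiv ℝ (gauge C) x x) 1 :=
    HasFDerivAt.comp_hasDerivAt (l := gauge C) (1 : ℝ) (by simpa using hd) h1
  have h3 : HasDerivAt (fun t : ℝ => gauge C (t • x)) (gauge C x) 1 := by
    have h4 : HasDerivAt (fun t : ℝ => t * gauge C x) (gauge C x) 1 := by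
      simpa using (hasDerivAt_id (1 : ℝ)).mul_const (gauge C x)
    refine h4.congr_of_eventuallyEq ?_
    filter_upwards [lt_mem_nhds (one_pos : (0 : ℝ) < 1)] with t ht
    rw [hC.gauge_smul, abs_of_pos ht]
  exact h2.unique h3

/-- Subadditivity bounds each forward difference quotient in direction `z` by `gauge C z`. -/
theorem fderiv_gauge_apply_le [CompleteSpace E] (hC : IsSmoothBody C) {x : E} (hx : x ≠ 0) (z : E) :
    fderiv ℝ (gauge C) x z ≤ gauge C z := by
  have hd := ((hC.contDiffAt_gauge hx).differentiableAt (by simp)).hasFDerivAt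
  have h1 : HasDerivAt (fun t : ℝ => x + t • z) z 0 := by
    simpa using ((hasDerivAt_id (0 : ℝ)).smul_const z).const_add x
  have h2 : HasDerivAt (fun t : ℝ => gauge C (x + t • z)) (fderiv ℝ (gauge C) x z) 0 :=
    HasFDerivAt.comp_hasDerivAt (l := gauge C) (0 : ℝ) (by simpa using hd) h1
  have h3 := (hasDerivAt_iff_tendsto_slope.1 h2).mono_left
    (show 𝓝[>] (0 : ℝ) ≤ 𝓝[≠] 0 from nhdsWithin_mono (0 : ℝ) (fun a (ha : 0 < a) => ha.ne'))
  refine le_of_tendsto h3 ?_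
  filter_upwards [self_mem_nhdsWithin] with t ht
  have ht : 0 < t := ht
  rw [slope_def_field, sub_zero, zero_smul, add_zero, div_le_iff₀ ht]
  have := hC.gauge_add_le x (t • z)
  rw [hC.gauge_smul, abs_of_pos ht] at this
  linarith

end IsSmoothBody

/-! ### The duality map and the description of `K⁺` and `K⁻` as graphs. -/

/-- Half of the square of the gauge of a set. -/
noncomputable def halfSqGauge {E : Type*} [NormedAddCommGroup E] [NormedSpace ℝ E] (C : Set E)
    (x : E) : ℝ :=
  gauge C x ^ 2 / 2

/-- The duality map of a convex body, the derivative of half of the square of its gauge. -/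
noncomputable def dualityMap {E : Type*} [NormedAddCommGroup E] [NormedSpace ℝ E] (C : Set E) :
    E → StrongDual ℝ E :=
  fderiv ℝ (halfSqGauge C)

namespace IsSmoothBody

section Basic

variable {E : Type*} [NormedAddCommGroup E] [NormedSpace ℝ E] {C : Set E}

theorem exists_gauge_le (hC : IsSmoothBody C) : ∃ c : ℝ, 0 < c ∧ ∀ x, gauge C x ≤ c * ‖x‖ := by
  obtain ⟨r, hr, hrC⟩ := Metric.mem_nhds_iff.1 hC.mem_nhds
  refine ⟨r⁻¹, inv_pos.2 hr, fun x => ?_⟩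
  have := mul_gauge_le_norm hrC (x := x)
  rwa [inv_mul_eq_div, le_div_iff₀' hr]

theorem exists_le_gauge (hC : IsSmoothBody C) : ∃ c : ℝ, 0 < c ∧ ∀ x, c * ‖x‖ ≤ gauge C x := by
  obtain ⟨r, hr, hCr⟩ := hC.isBounded.subset_closedBall_lt 0 0
  refine ⟨r⁻¹, inv_pos.2 hr, fun x => ?_⟩
  have := le_gauge_of_subset_closedBall (absorbent_nhds_zero hC.mem_nhds) hr.le hCr (x := x)
  rwa [inv_mul_eq_div]

theorem hasFDerivAt_halfSqGauge_zero (hC : IsSmoothBody C) :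
    HasFDerivAt (halfSqGauge C) (0 : StrongDual ℝ E) 0 := by
  obtain ⟨c, hc, hle⟩ := hC.exists_gauge_le
  have hO : (halfSqGauge C) =O[𝓝 0] fun x : E => ‖x - 0‖ ^ 2 := by
    refine Asymptotics.IsBigO.of_bound (c ^ 2) (Filter.Eventually.of_forall fun x => ?_)
    have h0 := gauge_nonneg (s := C) x
    rw [halfSqGauge, sub_zero, Real.norm_of_nonneg (by positivity),
      Real.norm_of_nonneg (by positivity), ← mul_pow]
    have := pow_le_pow_left₀ h0 (hle x) 2
    nlinarith [sq_nonneg (gauge C x)]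
  exact hO.hasFDerivAt (by norm_num)

variable [CompleteSpace E]

theorem hasFDerivAt_halfSqGauge (hC : IsSmoothBody C) {x : E} (hx : x ≠ 0) :
    HasFDerivAt (halfSqGauge C) (gauge C x • fderiv ℝ (gauge C) x) x := by
  have hd := ((hC.contDiffAt_gauge hx).differentiableAt (by simp)).hasFDerivAt
  have := (hd.pow 2).mul_const (2⁻¹ : ℝ)
  refine (this.congr_fderiv ?_).congr_of_eventuallyEq (Filter.Eventually.of_forall fun z => ?_)
  · ext z
    simp
    ring
  · simp [halfSqGauge, div_eq_mul_inv]

theorem contDiffAt_halfSqGauge (hC : IsSmoothBody C) {x : E} (hx : x ≠ 0) :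
    ContDiffAt ℝ ∞ (halfSqGauge C) x :=
  ((hC.contDiffAt_gauge hx).pow 2).div_const 2

theorem differentiable_halfSqGauge (hC : IsSmoothBody C) : Differentiable ℝ (halfSqGauge C) :=
  fun x => by
    by_cases hx : x = 0
    · exact hx ▸ hC.hasFDerivAt_halfSqGauge_zero.differentiableAt
    · exact (hC.hasFDerivAt_halfSqGauge hx).differentiableAt

omit [CompleteSpace E] in
theorem dualityMap_zero (hC : IsSmoothBody C) : dualityMap C 0 = 0 :=
  hC.hasFDerivAt_halfSqGauge_zero.fderiv

theorem dualityMap_of_ne_zero (hC : IsSmoothBody C) {x : E} (hx : x ≠ 0) :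
    dualityMap C x = gauge C x • fderiv ℝ (gauge C) x :=
  (hC.hasFDerivAt_halfSqGauge hx).fderiv

theorem dualityMap_apply_self (hC : IsSmoothBody C) (x : E) :
    dualityMap C x x = gauge C x ^ 2 := by
  by_cases hx : x = 0
  · simp [hx]
  · rw [hC.dualityMap_of_ne_zero hx]
    simp [hC.fderiv_gauge_apply_self hx, sq]

theorem dualityMap_apply_le (hC : IsSmoothBody C) (x z : E) :
    dualityMap C x z ≤ gauge C x * gauge C z := by
  by_cases hx : x = 0
  · simp [hx, hC.dualityMap_zero]
  · rw [hC.dualityMap_of_ne_zero hx]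
    exact mul_le_mul_of_nonneg_left (hC.fderiv_gauge_apply_le hx z) (gauge_nonneg _)

/-- Symmetry of the body covers negative scalars: the derivative of the gauge at `t • x` is `sign t`
times the one at `x`, because that functional is dominated by the gauge and touches it at `t • x`.
-/
theorem dualityMap_smul (hC : IsSmoothBody C) (t : ℝ) (x : E) :
    dualityMap C (t • x) = t • dualityMap C x := by
  by_cases hx : x = 0
  · simp [hx, hC.dualityMap_zero]
  by_cases ht : t = 0
  · simp [ht, hC.dualityMap_zero]
  have hs : t = SignType.sign t * |t| := (sign_mul_abs t).symm
  have key : fderiv ℝ (gauge C) (t • x) = (SignType.sign t : ℝ) • fderiv ℝ (gauge C) x := by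
    apply hC.fderiv_gauge_eq (smul_ne_zero ht hx)
    · intro z
      have h1 := hC.fderiv_gauge_apply_le hx z
      have h2 := hC.fderiv_gauge_apply_le hx (-z)
      rw [map_neg, hC.gauge_neg] at h2
      rcases lt_or_gt_of_ne ht with h | h
      · simp [sign_neg h]
        linarith
      · simpa [sign_pos h] using h1
    · rw [hC.gauge_smul]
      simp [hC.fderiv_gauge_apply_self hx, ← mul_assoc]
  rw [hC.dualityMap_of_ne_zero hx, hC.dualityMap_of_ne_zero (smul_ne_zero ht hx), key,
    hC.gauge_smul, smul_smul, smul_smul]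
  congr 1
  nth_rewrite 3 [hs]
  ring

theorem dualityMap_neg (hC : IsSmoothBody C) (x : E) : dualityMap C (-x) = -dualityMap C x := by
  have := hC.dualityMap_smul (-1) x
  rw [neg_one_smul] at this
  exact this.trans (neg_one_smul ℝ (dualityMap C x))

/-- A quantitative form of monotonicity. After expansion, the diagonal terms are squares of gauges
and the mixed terms are bounded by the product of the gauges. -/
theorem sq_sub_le_dualityMap (hC : IsSmoothBody C) (x y : E) :
    (gauge C x - gauge C y) ^ 2 ≤ (dualityMap C x - dualityMap C y) (x - y) := by
  have h1 := hC.dualityMap_apply_le x y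
  have h2 := hC.dualityMap_apply_le y x
  simp only [sub_apply, map_sub, hC.dualityMap_apply_self]
  nlinarith

theorem contDiffAt_dualityMap (hC : IsSmoothBody C) {x : E} (hx : x ≠ 0) :
    ContDiffAt ℝ ∞ (dualityMap C) x :=
  (hC.contDiffAt_halfSqGauge hx).fderiv_right (m := ∞) (by simp)

theorem dualityMap_mem_polar (hC : IsSmoothBody C) {x : E} (hx : gauge C x = 1) :
    dualityMap C x ∈ StrongDual.polar ℝ C := by
  intro z hz
  have hz1 := hC.gauge_le_one_iff.2 hz
  have h1 := hC.dualityMap_apply_le x z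
  have h2 := hC.dualityMap_apply_le x (-z)
  rw [map_neg, hC.gauge_neg] at h2
  rw [hx, one_mul] at h1 h2
  exact abs_le.2 ⟨neg_le.1 (h2.trans hz1), h1.trans hz1⟩

omit [CompleteSpace E] in
theorem apply_le_gauge_of_mem_polar (hC : IsSmoothBody C) {y : StrongDual ℝ E}
    (hy : y ∈ StrongDual.polar ℝ C) (z : E) : y z ≤ gauge C z := by
  by_cases hz : z = 0
  · simp [hz]
  have hg := hC.gauge_pos hz
  have hmem : (gauge C z)⁻¹ • z ∈ C :=
    hC.gauge_le_one_iff.1 (hC.gauge_inv_smul_self hz).le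
  have h1 := (le_abs_self _).trans (hy _ hmem)
  have h2 : (gauge C z)⁻¹ * y z ≤ 1 := by simpa using h1
  rwa [inv_mul_eq_div, div_le_one hg] at h2

/-- A functional in the polar that takes the value 1 at a point of the body supports the gauge
there, so it must be the derivative of the gauge. -/
theorem mem_plusPart_iff (hC : IsSmoothBody C) {w : E × StrongDual ℝ E} :
    w ∈ plusPart C ↔ gauge C w.1 = 1 ∧ w.2 = dualityMap C w.1 := by
  constructor
  · rintro ⟨h1, h2, h3⟩
    have hx : w.1 ≠ 0 := by
      rintro h
      simp [h] at h3
    have hg : gauge C w.1 = 1 :=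
      le_antisymm (hC.gauge_le_one_iff.2 h1) (h3 ▸ hC.apply_le_gauge_of_mem_polar h2 w.1)
    refine ⟨hg, ?_⟩
    rw [hC.dualityMap_of_ne_zero hx, hg, one_smul]
    exact (hC.fderiv_gauge_eq hx (hC.apply_le_gauge_of_mem_polar h2) (h3.trans hg.symm)).symm
  · rintro ⟨h1, h2⟩
    exact ⟨hC.gauge_le_one_iff.1 h1.le, h2 ▸ hC.dualityMap_mem_polar h1, by
      rw [h2, hC.dualityMap_apply_self, h1, one_pow]⟩

omit [CompleteSpace E] in
theorem mem_minusPart_iff_mem_plusPart {w : E × StrongDual ℝ E} :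
    w ∈ minusPart C ↔ (w.1, -w.2) ∈ plusPart C := by
  have : w.2 ∈ StrongDual.polar ℝ C ↔ -w.2 ∈ StrongDual.polar ℝ C := by
    simp [StrongDual.mem_polar_iff]
  simp only [minusPart, plusPart, mem_ofPred_eq, neg_apply, this, neg_eq_iff_eq_neg]

theorem mem_minusPart_iff (hC : IsSmoothBody C) {w : E × StrongDual ℝ E} :
    w ∈ minusPart C ↔ gauge C w.1 = 1 ∧ w.2 = -dualityMap C w.1 := by
  rw [mem_minusPart_iff_mem_plusPart, hC.mem_plusPart_iff]
  simp only [neg_eq_iff_eq_neg]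

end Basic

/-! ### Smoothness of the polar: strict monotonicity and positive definiteness. -/

section Polar

variable {V : Type*} [NormedAddCommGroup V] [NormedSpace ℝ V] [FiniteDimensional ℝ V] {K : Set V}

omit [FiniteDimensional ℝ V] in
theorem polar (hK : IsSmoothBody K) (h : HasSmoothBoundary (StrongDual.polar ℝ K)) :
    IsSmoothBody (StrongDual.polar ℝ K) where
  convex := by
    intro y hy z hz a b ha hb hab x hx
    have h1 := hy x hx
    have h2 := hz x hx
    simp only [LinearMap.flip_apply] at h1 h2 ⊢
    simp only [topDualPairing_apply, Real.norm_eq_abs, abs_le, add_apply, smul_apply,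
      smul_eq_mul] at h1 h2 ⊢
    constructor <;> nlinarith
  isClosed := NormedSpace.isClosed_polar ℝ K
  isBounded := NormedSpace.isBounded_polar_of_mem_nhds_zero ℝ hK.mem_nhds
  mem_nhds := by
    obtain ⟨r, hr, hKr⟩ := hK.isBounded.subset_closedBall_lt 0 0
    refine Filter.mem_of_superset (Metric.closedBall_mem_nhds 0 (inv_pos.2 hr)) fun y hy x hx => ?_
    have hx' : ‖x‖ ≤ r := by simpa using hKr hx
    have hy' : ‖y‖ ≤ r⁻¹ := by simpa using hy
    calc ‖y x‖ ≤ ‖y‖ * ‖x‖ := y.le_opNorm x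
      _ ≤ r⁻¹ * r := by gcongr
      _ = 1 := inv_mul_cancel₀ hr.ne'
  neg_mem := by
    intro y hy x hx
    simpa using hy x hx
  smooth := h

-- The supporting functional argument with the roles exchanged: `w.1`, seen as a functional on the
-- dual, supports the polar at `w.2`. Thus `w.2` determines `w.1`.
omit [FiniteDimensional ℝ V] in
theorem fderiv_gauge_polar (hP : IsSmoothBody (StrongDual.polar ℝ K))
    {w : V × StrongDual ℝ V} (hw : w ∈ plusPart K) :
    gauge (StrongDual.polar ℝ K) w.2 = 1 ∧
    fderiv ℝ (gauge (StrongDual.polar ℝ K)) w.2 =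
      NormedSpace.inclusionInDoubleDual ℝ V w.1 := by
  have hle : ∀ η : StrongDual ℝ V, NormedSpace.inclusionInDoubleDual ℝ V w.1 η ≤
      gauge (StrongDual.polar ℝ K) η := by
    apply hP.apply_le_gauge_of_mem_polar
    intro y hy
    exact hy _ hw.1
  have h1 : gauge (StrongDual.polar ℝ K) w.2 = 1 :=
    le_antisymm (hP.gauge_le_one_iff.2 hw.2.1) (by simpa [hw.2.2] using hle w.2)
  refine ⟨h1, hP.fderiv_gauge_eq ?_ hle ?_⟩
  · rintro h
    have := hw.2.2
    simp [h] at this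
  · simp [hw.2.2, h1]

/-- The duality maps of a body and of its polar are inverse to each other. -/
theorem dualityMap_polar_dualityMap (hK : IsSmoothBody K)
    (hP : IsSmoothBody (StrongDual.polar ℝ K)) (u : V) :
    dualityMap (StrongDual.polar ℝ K) (dualityMap K u) =
      NormedSpace.inclusionInDoubleDual ℝ V u := by
  by_cases hu : u = 0
  · simp [hu, hK.dualityMap_zero, hP.dualityMap_zero]
  have hg := hK.gauge_pos hu
  set x := (gauge K u)⁻¹ • u with hx
  have hux : u = gauge K u • x := by rw [hx, smul_inv_smul₀ hg.ne']
  have hw : (x, dualityMap K x) ∈ plusPart K :=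
    hK.mem_plusPart_iff.2 ⟨hK.gauge_inv_smul_self hu, rfl⟩
  have hne : dualityMap K x ≠ 0 := by
    intro h
    have := hw.2.2
    simp [h] at this
  have h := hP.fderiv_gauge_polar hw
  rw [hux, hK.dualityMap_smul, hP.dualityMap_smul, hP.dualityMap_of_ne_zero hne, h.1, h.2,
    one_smul]
  exact (map_smul _ _ _).symm

theorem eq_of_dualityMap_sub_apply_eq_zero (hK : IsSmoothBody K)
    (hP : IsSmoothBody (StrongDual.polar ℝ K)) {x y : V}
    (h : (dualityMap K x - dualityMap K y) (x - y) = 0) : x = y := by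
  have h0 := hK.sq_sub_le_dualityMap x y
  rw [h] at h0
  have hxy : gauge K x = gauge K y := sub_eq_zero.1 (pow_eq_zero_iff (two_ne_zero) |>.1
    (le_antisymm h0 (sq_nonneg _)))
  have h1 := hK.dualityMap_apply_le x y
  have h2 := hK.dualityMap_apply_le y x
  simp only [sub_apply, map_sub, hK.dualityMap_apply_self, hxy] at h h1 h2
  -- The two mixed terms add up to `2 * gauge K y ^ 2` and neither exceeds half of this, so both
  -- bounds are attained.
  have h3 : dualityMap K x y = gauge K y ^ 2 := by nlinarith
  by_cases hy : y = 0
  · by_contra hx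
    have := hK.gauge_pos (x := x) (by rwa [hy] at hx)
    rw [hxy, hy, gauge_zero] at this
    exact this.false
  have hg := hK.gauge_pos hy
  have hx : x ≠ 0 := by
    rintro rfl
    rw [gauge_zero] at hxy
    exact hg.ne hxy
  set r := gauge K y with hr
  -- Both `r⁻¹ • x` and `r⁻¹ • y` pair to 1 with `dualityMap K (r⁻¹ • x)`. They therefore both give
  -- the derivative of the polar gauge at that functional, and coincide.
  have hw : ∀ z, gauge K z = r → dualityMap K x z = r ^ 2 →
      (r⁻¹ • z, dualityMap K (r⁻¹ • x)) ∈ plusPart K := by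
    intro z hz1 hz2
    refine ⟨hK.gauge_le_one_iff.1 ?_, hK.dualityMap_mem_polar ?_, ?_⟩
    · rw [hK.gauge_smul, hz1, abs_of_pos (inv_pos.2 hg), inv_mul_cancel₀ hg.ne']
    · rw [hK.gauge_smul, hxy, abs_of_pos (inv_pos.2 hg), inv_mul_cancel₀ hg.ne']
    · rw [hK.dualityMap_smul]
      simp [hz2]
      field_simp
  have e1 := (hP.fderiv_gauge_polar (hw x hxy (by rw [hK.dualityMap_apply_self, hxy]))).2
  have e2 := (hP.fderiv_gauge_polar (hw y rfl h3)).2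
  have e3 : NormedSpace.inclusionInDoubleDual ℝ V (r⁻¹ • x) =
    NormedSpace.inclusionInDoubleDual ℝ V (r⁻¹ • y) := e1.symm.trans e2
  have e4 := (NormedSpace.inclusionInDoubleDualLi (E := V) ℝ).injective e3
  exact smul_right_injective V (inv_ne_zero hg.ne') e4

/-- Chain rule for the composition of the two duality maps, which is the injective canonical map to
the double dual. -/
theorem eq_zero_of_fderiv_dualityMap_apply_eq_zero (hK : IsSmoothBody K)
    (hP : IsSmoothBody (StrongDual.polar ℝ K)) {u : V} (hu : u ≠ 0) {a : V}
    (h : fderiv ℝ (dualityMap K) u a = 0) : a = 0 := by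
  have hD := ((hK.contDiffAt_dualityMap hu).differentiableAt (by simp)).hasFDerivAt
  have hne : dualityMap K u ≠ 0 := by
    intro h0
    have := hK.dualityMap_apply_self u
    rw [h0] at this
    exact (pow_pos (hK.gauge_pos hu) 2).ne this
  have hD' := ((hP.contDiffAt_dualityMap hne).differentiableAt (by simp)).hasFDerivAt
  have hcomp := hD'.comp u hD
  have heq : dualityMap (StrongDual.polar ℝ K) ∘ dualityMap K =
      NormedSpace.inclusionInDoubleDual ℝ V :=
    funext (hK.dualityMap_polar_dualityMap hP)
  rw [heq] at hcomp
  have := congrArg (fun L => L a) (hcomp.unique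
    (NormedSpace.inclusionInDoubleDual ℝ V).hasFDerivAt)
  simp only [ContinuousLinearMap.comp_apply, h, map_zero] at this
  exact (NormedSpace.inclusionInDoubleDualLi (E := V) ℝ).injective (this.symm.trans (map_zero (NormedSpace.inclusionInDoubleDual ℝ V)).symm)

omit [FiniteDimensional ℝ V] in
theorem fderiv_dualityMap_symm [CompleteSpace V] (hK : IsSmoothBody K) {u : V} (hu : u ≠ 0)
    (a b : V) : fderiv ℝ (dualityMap K) u a b = fderiv ℝ (dualityMap K) u b a :=
  (hK.contDiffAt_halfSqGauge hu).isSymmSndFDerivAt (by simp; exact WithTop.coe_le_coe.2 le_top) a b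

omit [FiniteDimensional ℝ V] in
theorem fderiv_dualityMap_nonneg [CompleteSpace V] (hK : IsSmoothBody K) {u : V} (hu : u ≠ 0)
    (a : V) : 0 ≤ fderiv ℝ (dualityMap K) u a a := by
  have hD := ((hK.contDiffAt_dualityMap hu).differentiableAt (by simp)).hasFDerivAt
  have h1 : HasDerivAt (fun t : ℝ => u + t • a) a 0 := by
    simpa using ((hasDerivAt_id (0 : ℝ)).smul_const a).const_add u
  have h2 : HasDerivAt (fun t : ℝ => dualityMap K (u + t • a)) (fderiv ℝ (dualityMap K) u a) 0 :=
    HasFDerivAt.comp_hasDerivAt (l := dualityMap K) (0 : ℝ) (by simpa using hD) h1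
  have h3 : HasDerivAt (fun t : ℝ => dualityMap K (u + t • a) a)
      (fderiv ℝ (dualityMap K) u a a) 0 := by
    have := h2.clm_apply (hasDerivAt_const (0 : ℝ) a)
    simpa using this
  have h4 := (hasDerivAt_iff_tendsto_slope.1 h3).mono_left
    (show 𝓝[>] (0 : ℝ) ≤ 𝓝[≠] 0 from nhdsWithin_mono (0 : ℝ) (fun a (ha : 0 < a) => ha.ne'))
  refine ge_of_tendsto h4 ?_
  filter_upwards [self_mem_nhdsWithin] with t ht
  have ht : 0 < t := ht
  rw [slope_def_field, sub_zero, zero_smul, add_zero]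
  refine div_nonneg ?_ ht.le
  have h5 := (sq_nonneg _).trans (hK.sq_sub_le_dualityMap (u + t • a) u)
  rw [add_sub_cancel_left, map_smul, smul_eq_mul] at h5
  simpa using nonneg_of_mul_nonneg_right h5 ht

/-- The derivative of the duality map is positive definite. -/
theorem fderiv_dualityMap_pos (hK : IsSmoothBody K) (hP : IsSmoothBody (StrongDual.polar ℝ K))
    {u : V} (hu : u ≠ 0) {a : V} (h : fderiv ℝ (dualityMap K) u a a = 0) : a = 0 := by
  apply hK.eq_zero_of_fderiv_dualityMap_apply_eq_zero hP hu
  ext b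
  set B := fderiv ℝ (dualityMap K) u with hB
  have hsymm : B a b = B b a := hK.fderiv_dualityMap_symm hu a b
  -- As in the proof of the Cauchy–Schwarz inequality: the semidefinite form at `a + t • b`, whose
  -- constant term vanishes, cannot have a nonzero linear term.
  have hq : ∀ t : ℝ, 0 ≤ 2 * t * B a b + B b b * t ^ 2 := by
    intro t
    have := hK.fderiv_dualityMap_nonneg hu (a + t • b)
    simp only [← hB, map_add, map_smul, add_apply, smul_apply, smul_eq_mul, h, ← hsymm] at this
    linarith
  by_contra hne
  have hne : B a b ≠ 0 := hne
  have hbb : 0 ≤ B b b := hK.fderiv_dualityMap_nonneg hu b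
  -- This `t` makes the expression negative unless `B a b = 0`; the added 1 keeps the denominator
  -- positive when `B b b = 0`.
  have := hq (-(B a b) / (B b b + 1))
  have hpos : 0 < B b b + 1 := by linarith
  have e : 2 * (-(B a b) / (B b b + 1)) * B a b + B b b * (-(B a b) / (B b b + 1)) ^ 2 =
      -((B a b) ^ 2 * (B b b + 2) / (B b b + 1) ^ 2) := by
    field_simp
    ring
  rw [e] at this
  have : 0 < (B a b) ^ 2 * (B b b + 2) / (B b b + 1) ^ 2 := by positivity
  linarith

end Polar

end IsSmoothBody

/-! ### The homogeneous bijection underlying the join map. -/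

/-- The map `(u, v) ↦ (u + v, D u - D v)`, where `D` is the duality map. -/
noncomputable def sumDiffMap {V : Type*} [NormedAddCommGroup V] [NormedSpace ℝ V] (K : Set V)
    (p : V × V) : V × StrongDual ℝ V :=
  (p.1 + p.2, dualityMap K p.1 - dualityMap K p.2)

namespace IsSmoothBody

variable {V : Type*} [NormedAddCommGroup V] [NormedSpace ℝ V] [FiniteDimensional ℝ V] {K : Set V}

omit [FiniteDimensional ℝ V] in
theorem sumDiffMap_smul [CompleteSpace V] (hK : IsSmoothBody K) (t : ℝ) (p : V × V) :
    sumDiffMap K (t • p) = t • sumDiffMap K p := by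
  simp [sumDiffMap, hK.dualityMap_smul, smul_sub]

omit [FiniteDimensional ℝ V] in
theorem sumDiffMap_zero : sumDiffMap K 0 = 0 := by
  simp [sumDiffMap]

/-- If two pairs have the same image, then the differences of their components are opposite while
those of their duality images agree. The two monotonicity pairings then have opposite signs, so both
vanish. -/
theorem sumDiffMap_injective (hK : IsSmoothBody K) (hP : IsSmoothBody (StrongDual.polar ℝ K)) :
    Function.Injective (sumDiffMap K) := by
  rintro ⟨u, v⟩ ⟨u', v'⟩ h
  obtain ⟨h1, h2⟩ := Prod.ext_iff.1 h
  simp only [sumDiffMap] at h1 h2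
  have h3 : u - u' = -(v - v') := by
    rw [neg_sub, sub_eq_sub_iff_add_eq_add, h1, add_comm]
  have h4 : dualityMap K u - dualityMap K u' = dualityMap K v - dualityMap K v' := by
    rw [sub_eq_sub_iff_add_eq_add] at h2 ⊢
    rw [h2]
    exact add_comm _ _
  have h5 : (dualityMap K u - dualityMap K u') (u - u') =
      -(dualityMap K v - dualityMap K v') (v - v') := by
    rw [h4, h3, map_neg]
  have h6 := (sq_nonneg _).trans (hK.sq_sub_le_dualityMap u u')
  have h7 := (sq_nonneg _).trans (hK.sq_sub_le_dualityMap v v')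
  rw [hK.eq_of_dualityMap_sub_apply_eq_zero hP (x := u) (y := u') (by linarith),
    hK.eq_of_dualityMap_sub_apply_eq_zero hP (x := v) (y := v') (by linarith)]

theorem sumDiffMap_surjective (hK : IsSmoothBody K) : Function.Surjective (sumDiffMap K) := by
  rintro ⟨a, b⟩
  -- At a critical point of `φ`, `D u + D (u - a) = b`. Since `D` is odd, `(u, a - u)` is the
  -- required preimage. The quadratic lower bound on the gauge makes `φ` coercive, so a minimum
  -- exists.
  set φ : V → ℝ := fun u => halfSqGauge K u + halfSqGauge K (u - a) - b u with hφ
  have hdiff := hK.differentiable_halfSqGauge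
  have hcont : Continuous φ :=
    ((hdiff.continuous).add (hdiff.continuous.comp (continuous_id.sub continuous_const))).sub
      b.continuous
  obtain ⟨c, hc, hle⟩ := hK.exists_le_gauge
  have hbound : ∀ u, ‖u‖ * (c ^ 2 / 2 * ‖u‖ - ‖b‖) ≤ φ u := by
    intro u
    have h1 : b u ≤ ‖b‖ * ‖u‖ := (le_abs_self _).trans (b.le_opNorm u)
    have h2 : (c * ‖u‖) ^ 2 ≤ gauge K u ^ 2 := pow_le_pow_left₀ (by positivity) (hle u) 2
    have h3 : 0 ≤ halfSqGauge K (u - a) := by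
      rw [halfSqGauge]
      positivity
    simp only [hφ]
    rw [halfSqGauge]
    nlinarith
  have htend : Filter.Tendsto φ (Filter.cocompact V) Filter.atTop := by
    have hn := tendsto_norm_cocompact_atTop (E := V)
    refine Filter.tendsto_atTop_mono hbound ?_
    refine hn.atTop_mul_atTop₀ ?_
    exact Filter.tendsto_atTop_add_const_right _ _ (hn.const_mul_atTop (by positivity))
  obtain ⟨u, hu⟩ := hcont.exists_forall_le htend
  have hd : HasFDerivAt φ (dualityMap K u + dualityMap K (u - a) - b) u := by
    refine ((hdiff u).hasFDerivAt.add ?_).sub b.hasFDerivAt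
    exact (hasFDerivAt_comp_sub a).2 (hdiff (u - a)).hasFDerivAt
  have hmin : IsLocalMin φ u := Filter.Eventually.of_forall hu
  have h0 := hmin.hasFDerivAt_eq_zero hd
  refine ⟨(u, a - u), ?_⟩
  have h1 : dualityMap K (a - u) = -dualityMap K (u - a) := by
    rw [← hK.dualityMap_neg, neg_sub]
  refine Prod.ext (by simp [sumDiffMap]) ?_
  simp only [sumDiffMap, h1, sub_neg_eq_add]
  exact sub_eq_zero.1 h0

omit [FiniteDimensional ℝ V] in
theorem contDiffAt_sumDiffMap [CompleteSpace V] (hK : IsSmoothBody K) {p : V × V} (h1 : p.1 ≠ 0)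
    (h2 : p.2 ≠ 0) : ContDiffAt ℝ ∞ (sumDiffMap K) p :=
  (contDiffAt_fst.add contDiffAt_snd).prodMk
    (((hK.contDiffAt_dualityMap h1).comp p contDiffAt_fst).sub
      ((hK.contDiffAt_dualityMap h2).comp p contDiffAt_snd))

theorem exists_hasFDerivAt_sumDiffMap (hK : IsSmoothBody K)
    (hP : IsSmoothBody (StrongDual.polar ℝ K)) {p : V × V} (h1 : p.1 ≠ 0) (h2 : p.2 ≠ 0) :
    ∃ L : (V × V) ≃L[ℝ] (V × StrongDual ℝ V),
      HasFDerivAt (sumDiffMap K) (L : (V × V) →L[ℝ] (V × StrongDual ℝ V)) p := by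
  have hD1 := ((hK.contDiffAt_dualityMap h1).differentiableAt (by simp)).hasFDerivAt
  have hD2 := ((hK.contDiffAt_dualityMap h2).differentiableAt (by simp)).hasFDerivAt
  set B1 := fderiv ℝ (dualityMap K) p.1 with hB1
  set B2 := fderiv ℝ (dualityMap K) p.2 with hB2
  have hd : HasFDerivAt (sumDiffMap K)
      ((ContinuousLinearMap.fst ℝ V V + ContinuousLinearMap.snd ℝ V V).prod
        (B1.comp (ContinuousLinearMap.fst ℝ V V) - B2.comp (ContinuousLinearMap.snd ℝ V V))) p :=
    (hasFDerivAt_fst.add hasFDerivAt_snd).prodMk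
      ((hD1.comp p hasFDerivAt_fst).sub (hD2.comp p hasFDerivAt_snd))
  set A := (ContinuousLinearMap.fst ℝ V V + ContinuousLinearMap.snd ℝ V V).prod
        (B1.comp (ContinuousLinearMap.fst ℝ V V) - B2.comp (ContinuousLinearMap.snd ℝ V V)) with hA
  -- A kernel vector has the form `(a, -a)` with `B1 a + B2 a = 0`. Evaluating at `a` gives a
  -- vanishing sum of two nonnegative terms, the first of which is positive unless `a = 0`.
  have hinj : Function.Injective (A : (V × V) →ₗ[ℝ] (V × StrongDual ℝ V)) := by
    rw [injective_iff_map_eq_zero]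
    rintro ⟨a, b⟩ hab
    obtain ⟨e1, e2⟩ := Prod.ext_iff.1 hab
    have e1 : a + b = 0 := by simpa [hA] using e1
    have e2 : B1 a - B2 b = 0 := by simpa [hA] using e2
    have hb : b = -a := (neg_eq_of_add_eq_zero_right e1).symm
    rw [hb, map_neg, sub_neg_eq_add] at e2
    have e3 : B1 a a + B2 a a = 0 := by
      rw [← add_apply, e2, zero_apply]
    have e4 := hK.fderiv_dualityMap_nonneg h1 a
    have e5 := hK.fderiv_dualityMap_nonneg h2 a
    have ha : a = 0 := hK.fderiv_dualityMap_pos hP h1 (by linarith)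
    simp [hb, ha]
  have hrank : Module.finrank ℝ (V × V) = Module.finrank ℝ (V × StrongDual ℝ V) := by
    have : Module.finrank ℝ (StrongDual ℝ V) = Module.finrank ℝ V := by
      rw [← (LinearMap.toContinuousLinearMap (𝕜 := ℝ) (E := V) (F' := ℝ)).finrank_eq]
      exact Subspace.dual_finrank_eq
    rw [Module.finrank_prod, Module.finrank_prod, this]
  refine ⟨(LinearEquiv.ofInjectiveOfFinrankEq (A : (V × V) →ₗ[ℝ] (V × StrongDual ℝ V)) hinj
    hrank).toContinuousLinearEquiv, hd.congr_fderiv ?_⟩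
  ext <;> rfl

/-- The inverse of the map `(u, v) ↦ (u + v, D u - D v)`. -/
noncomputable def sumDiffInv (K : Set V) : V × StrongDual ℝ V → V × V :=
  Function.invFun (sumDiffMap K)

theorem sumDiffInv_sumDiffMap (hK : IsSmoothBody K) (hP : IsSmoothBody (StrongDual.polar ℝ K))
    (p : V × V) : sumDiffInv K (sumDiffMap K p) = p :=
  Function.leftInverse_invFun (hK.sumDiffMap_injective hP) p

theorem differentiableAt_sumDiffInv (hK : IsSmoothBody K)
    (hP : IsSmoothBody (StrongDual.polar ℝ K)) {p : V × V} (h1 : p.1 ≠ 0) (h2 : p.2 ≠ 0) :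
    DifferentiableAt ℝ (sumDiffInv K) (sumDiffMap K p) := by
  obtain ⟨L, hL⟩ := hK.exists_hasFDerivAt_sumDiffMap hP h1 h2
  have := (hK.contDiffAt_sumDiffMap h1 h2).hasStrictFDerivAt' hL (by simp)
  exact (this.to_local_left_inverse
    (Filter.Eventually.of_forall (hK.sumDiffInv_sumDiffMap hP))).hasFDerivAt.differentiableAt

end IsSmoothBody

/-! ### Criteria for immersions and embeddings. -/

/-- The inverse function theorem, with smoothness on the whole source and target. -/
theorem ContDiffOn.exists_openPartialHomeomorph {E : Type*} [NormedAddCommGroup E]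
    [NormedSpace ℝ E] [CompleteSpace E] {G : E → E} {O : Set E} (hO : IsOpen O)
    (hG : ContDiffOn ℝ ∞ G O) {z : E} (hz : z ∈ O) {L : E ≃L[ℝ] E}
    (hL : HasFDerivAt G (L : E →L[ℝ] E) z) :
    ∃ e : OpenPartialHomeomorph E E, z ∈ e.source ∧ e.source ⊆ O ∧ (∀ y, e y = G y) ∧
      ContDiffOn ℝ ∞ e e.source ∧ ContDiffOn ℝ ∞ e.symm e.target := by
  have hGz : ContDiffAt ℝ ∞ G z := hG.contDiffAt (hO.mem_nhds hz)
  set e₀ := hGz.toOpenPartialHomeomorph G hL (by simp) with he₀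
  -- Invertibility of the derivative is an open condition; restricting to `S` makes the inverse
  -- smooth on the whole target.
  set S : Set E := O ∩ fderiv ℝ G ⁻¹' range ((↑) : (E ≃L[ℝ] E) → E →L[ℝ] E) with hS
  have hSo : IsOpen S :=
    (hG.continuousOn_fderiv_of_isOpen hO (by simp)).isOpen_inter_preimage hO
      ContinuousLinearEquiv.isOpen
  have hzS : z ∈ S := ⟨hz, L, hL.fderiv.symm⟩
  have hsource : (e₀.restrOpen S hSo).source = e₀.source ∩ S := rfl
  refine ⟨e₀.restrOpen S hSo, ⟨hGz.mem_toOpenPartialHomeomorph_source hL (by simp), hzS⟩,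
    fun y hy => hy.2.1, fun y => rfl, fun y hy => ?_, fun y hy => ?_⟩
  · exact (hG.contDiffAt (hO.mem_nhds hy.2.1)).contDiffWithinAt
  · have hy' := (e₀.restrOpen S hSo).map_target hy
    obtain ⟨hyO, L', hL'⟩ := hy'.2
    have hc : ContDiffAt ℝ ∞ G ((e₀.restrOpen S hSo).symm y) := hG.contDiffAt (hO.mem_nhds hyO)
    refine ((e₀.restrOpen S hSo).contDiffAt_symm (f₀' := L') hy ?_ hc).contDiffWithinAt
    rw [hL']
    exact (hc.differentiableAt (by simp)).hasFDerivAt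

theorem exists_continuousLinearEquiv_prod {X F E : Type*} [NormedAddCommGroup X] [NormedSpace ℝ X]
    [NormedAddCommGroup F] [NormedSpace ℝ F] [NormedAddCommGroup E] [NormedSpace ℝ E]
    [FiniteDimensional ℝ X] [FiniteDimensional ℝ F] [FiniteDimensional ℝ E] {A : X →L[ℝ] E}
    (hA : Function.Injective A)
    (hF : Module.finrank ℝ X + Module.finrank ℝ F = Module.finrank ℝ E) :
    ∃ L : (X × F) ≃L[ℝ] E, ∀ v, L (v, 0) = A v := by
  obtain ⟨C, hC⟩ := Submodule.exists_isCompl (LinearMap.range (A : X →ₗ[ℝ] E))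
  have h1 := Submodule.finrank_add_eq_of_isCompl hC
  have h2 : Module.finrank ℝ (LinearMap.range (A : X →ₗ[ℝ] E)) = Module.finrank ℝ X :=
    LinearMap.finrank_range_of_inj hA
  let eF : F ≃ₗ[ℝ] C := LinearEquiv.ofFinrankEq F C (by omega)
  let L := ((LinearEquiv.ofInjective (A : X →ₗ[ℝ] E) hA).prodCongr eF).trans
    (Submodule.prodEquivOfIsCompl _ C hC)
  refine ⟨L.toContinuousLinearEquiv, fun v => ?_⟩
  show L (v, 0) = A v
  simp [L]

/-- A map into a vector space that is smooth with injective derivative in a global chart is an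
immersion. -/
theorem isImmersion_of_injective_fderiv {M X F E : Type*} [TopologicalSpace M]
    [NormedAddCommGroup X] [NormedSpace ℝ X] [NormedAddCommGroup F] [NormedSpace ℝ F]
    [NormedAddCommGroup E] [NormedSpace ℝ E] [FiniteDimensional ℝ X] [FiniteDimensional ℝ F]
    [FiniteDimensional ℝ E]
    (hF : Module.finrank ℝ X + Module.finrank ℝ F = Module.finrank ℝ E) [ChartedSpace X M]
    [IsManifold 𝓘(ℝ, X) ∞ M] {φ : OpenPartialHomeomorph M X}
    (hφ : φ ∈ IsManifold.maximalAtlas 𝓘(ℝ, X) ∞ M) (hsource : φ.source = univ)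
    {f : M → E} {P : X → E} (hP : ContDiffOn ℝ ∞ P φ.target)
    (hP' : ∀ q ∈ φ.target, Function.Injective (fderiv ℝ P q)) (hf : ∀ x, f x = P (φ x)) :
    IsImmersionOfComplement F 𝓘(ℝ, X) 𝓘(ℝ, E) ∞ f := by
  intro x
  have hx : φ x ∈ φ.target := φ.map_source (by simp [hsource])
  obtain ⟨L, hL⟩ := exists_continuousLinearEquiv_prod (hP' _ hx) hF
  -- `G` thickens `P` along a complement of the range of its derivative at `φ x`. As `L` extends
  -- that derivative, `G` has derivative the identity at `L (φ x, 0)`, and its local inverse is a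
  -- chart that straightens the image of `P`.
  set G : E → E := fun z => P (L.symm z).1 + L (0, (L.symm z).2) with hG
  set O : Set E := (fun z => (L.symm z).1) ⁻¹' φ.target with hOdef
  have hO : IsOpen O := φ.open_target.preimage (by fun_prop)
  have hGc : ContDiffOn ℝ ∞ G O := by
    refine ContDiffOn.add (hP.comp (t := φ.target) ?_ (fun z hz => hz)) ?_
    · exact (contDiff_fst.comp L.symm.contDiff).contDiffOn
    · exact (L.contDiff.comp (contDiff_const.prodMk
        (contDiff_snd.comp L.symm.contDiff))).contDiffOn
  have hGL : ∀ q, G (L (q, 0)) = P q := fun q => by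
    simp only [hG, ContinuousLinearEquiv.symm_apply_apply]
    rw [← Prod.zero_eq_mk, map_zero, add_zero]
  have hz : L (φ x, 0) ∈ O := by simpa [hOdef] using hx
  have hPd : HasFDerivAt P (fderiv ℝ P (φ x)) (φ x) :=
    ((hP.contDiffAt (φ.open_target.mem_nhds hx)).differentiableAt (by simp)).hasFDerivAt
  have hGd : HasFDerivAt G ((ContinuousLinearEquiv.refl ℝ E : E ≃L[ℝ] E) : E →L[ℝ] E)
      (L (φ x, 0)) := by
    have e1 : HasFDerivAt (fun z => (L.symm z).1)
        ((ContinuousLinearMap.fst ℝ X F).comp (L.symm : E →L[ℝ] X × F)) (L (φ x, 0)) :=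
      ((ContinuousLinearMap.fst ℝ X F).comp (L.symm : E →L[ℝ] X × F)).hasFDerivAt
    have e2 : HasFDerivAt (fun z => L (0, (L.symm z).2))
        ((L : X × F →L[ℝ] E).comp (((0 : E →L[ℝ] X)).prod
          ((ContinuousLinearMap.snd ℝ X F).comp (L.symm : E →L[ℝ] X × F)))) (L (φ x, 0)) :=
      ((L : X × F →L[ℝ] E).comp (((0 : E →L[ℝ] X)).prod
          ((ContinuousLinearMap.snd ℝ X F).comp (L.symm : E →L[ℝ] X × F)))).hasFDerivAt
    have e3 : HasFDerivAt P (fderiv ℝ P (φ x)) (L.symm (L (φ x, 0))).1 := by simpa using hPd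
    refine ((HasFDerivAt.comp (g := P) (L (φ x, 0)) e3 e1).add e2).congr_fderiv ?_
    ext z
    obtain ⟨⟨v, c⟩, rfl⟩ := L.surjective z
    simp [← hL, ← map_add]
  obtain ⟨e, hze, heO, heG, hec, hec'⟩ := hGc.exists_openPartialHomeomorph hO hz hGd
  have hcod : e.symm ∈ IsManifold.maximalAtlas 𝓘(ℝ, E) ∞ E :=
    OpenPartialHomeomorph.mem_maximalAtlas_of_contMDiffOn e.symm hec'.contMDiffOn hec.contMDiffOn
  have hso : IsOpen ((fun q => L (q, 0)) ⁻¹' e.source) :=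
    e.open_source.preimage (by fun_prop)
  have hso' : IsOpen (φ.source ∩ φ ⁻¹' ((fun q => L (q, 0)) ⁻¹' e.source)) :=
    φ.isOpen_inter_preimage hso
  have hfx : ∀ y, L (φ y, 0) ∈ e.source → f y ∈ e.target := fun y hy => by
    rw [hf, ← hGL, ← heG]
    exact e.map_source hy
  have hfc : ContinuousAt f x := by
    have h1 : ContinuousAt φ x := φ.continuousAt (by simp [hsource])
    have h2 : ContinuousAt P (φ x) := hPd.continuousAt
    have h3 : f = P ∘ φ := funext hf
    rw [h3]
    exact h2.comp h1
  refine IsImmersionAtOfComplement.mk_of_continuousAt hfc L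
    (φ.restr (φ.source ∩ φ ⁻¹' ((fun q => L (q, 0)) ⁻¹' e.source))) e.symm ?_ (hfx x hze) ?_ hcod ?_
  · rw [φ.restr_source' _ hso']
    exact ⟨by simp [hsource], by simp [hsource], hze⟩
  · exact restr_mem_maximalAtlas _ hφ hso'
  · intro q hq
    have hq : q ∈ (φ.restr (φ.source ∩ φ ⁻¹' ((fun q => L (q, 0)) ⁻¹' e.source))).target := by
      simpa using hq
    have hq1 := OpenPartialHomeomorph.map_target _ hq
    rw [φ.restr_source' _ hso'] at hq1
    have hqt : q ∈ φ.target := hq.1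
    have hq2 : φ (φ.symm q) = q := φ.right_inv hqt
    have hq3 : L (q, 0) ∈ e.source := by
      have := hq1.2.2
      simpa [hq2] using this
    show e.symm (f (φ.symm q)) = L (q, 0)
    rw [hf, hq2, ← hGL, ← heG, e.left_inv hq3]

theorem isEmbedding_restrict_of_leftInverse {X Y : Type*} [TopologicalSpace X] [TopologicalSpace Y]
    {U : Set X} {Q : X → Y} {G : Y → X} (hQ : ContinuousOn Q U)
    (hG : ∀ q ∈ U, ContinuousAt G (Q q)) (hGQ : ∀ q ∈ U, G (Q q) = q) :
    IsEmbedding (fun q : U => Q q) := by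
  let g : U → Q '' U := fun q => ⟨Q q, mem_image_of_mem Q q.2⟩
  let r : Q '' U → X := fun y => G y
  have hg : Continuous g := hQ.domRestrict.subtype_mk _
  have hr : Continuous r := by
    rw [continuous_iff_continuousAt]
    rintro ⟨_, q, hq, rfl⟩
    exact ContinuousAt.comp (g := G) (hG q hq) continuousAt_subtype_val
  have hrg : r ∘ g = Subtype.val := funext fun q => hGQ q q.2
  have : IsEmbedding g := .of_comp hg hr (hrg ▸ IsEmbedding.subtypeVal)
  exact IsEmbedding.subtypeVal.comp this

theorem injective_fderiv_of_leftInverse {X E : Type*} [NormedAddCommGroup X] [NormedSpace ℝ X]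
    [NormedAddCommGroup E] [NormedSpace ℝ E] {P : X → E} {G : E → X} {q : X}
    (hP : DifferentiableAt ℝ P q) (hG : DifferentiableAt ℝ G (P q))
    (hGP : ∀ᶠ p in 𝓝 q, G (P p) = p) : Function.Injective (fderiv ℝ P q) := by
  have h1 := hG.hasFDerivAt.comp q hP.hasFDerivAt
  have h2 : HasFDerivAt (G ∘ P) (ContinuousLinearMap.id ℝ X) q :=
    (hasFDerivAt_id q).congr_of_eventuallyEq hGP
  have h3 := h1.unique h2
  intro v w hvw
  have h4 := congrArg (fun A => A v) h3
  have h5 := congrArg (fun A => A w) h3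
  simp only [ContinuousLinearMap.comp_apply, ContinuousLinearMap.id_apply] at h4 h5
  rw [← h4, ← h5, hvw]

/-- A set with a global smooth parametrization that has a differentiable left inverse is an
embedded submanifold, and a smooth map restricts to a smooth embedding of it if its composition
with the parametrization has a differentiable left inverse, too. -/
theorem isSmoothEmbeddingOn_of_leftInverse {E F : Type*} [NormedAddCommGroup E] [NormedSpace ℝ E]
    [FiniteDimensional ℝ E] [NormedAddCommGroup F] [NormedSpace ℝ F] [FiniteDimensional ℝ F]
    {m : ℕ} (hmE : m ≤ Module.finrank ℝ E) (hmF : m ≤ Module.finrank ℝ F) {M : Set E} {f : E → F}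
    (hf : ContDiff ℝ ∞ f) {U : Set (EuclideanSpace ℝ (Fin m))} (hU : IsOpen U)
    {P : EuclideanSpace ℝ (Fin m) → E} (hP : ContDiffOn ℝ ∞ P U) (hPM : P '' U = M)
    {G₁ : E → EuclideanSpace ℝ (Fin m)} (hG₁ : ∀ q ∈ U, DifferentiableAt ℝ G₁ (P q))
    (hG₁P : ∀ q ∈ U, G₁ (P q) = q)
    {G₂ : F → EuclideanSpace ℝ (Fin m)} (hG₂ : ∀ q ∈ U, DifferentiableAt ℝ G₂ (f (P q)))
    (hG₂P : ∀ q ∈ U, G₂ (f (P q)) = q) :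
    IsSmoothEmbeddingOn m M f := by
  subst hPM
  rcases isEmpty_or_nonempty (P '' U) with hemp | hne
  · let := ChartedSpace.empty (EuclideanSpace ℝ (Fin m)) (P '' U)
    refine ⟨inferInstance, IsManifold.empty _, ⟨?_, IsEmbedding.subtypeVal⟩,
      ⟨?_, IsEmbedding.of_subsingleton _⟩⟩
    · exact ⟨E, inferInstance, inferInstance, fun x => hemp.elim x⟩
    · exact ⟨F, inferInstance, inferInstance, fun x => hemp.elim x⟩
  let h : P '' U ≃ₜ U :=
    { toFun := fun x => ⟨G₁ x, by
        obtain ⟨_, q, hq, rfl⟩ := x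
        rwa [hG₁P q hq]⟩
      invFun := fun q => ⟨P q, mem_image_of_mem P q.2⟩
      left_inv := by
        rintro ⟨_, q, hq, rfl⟩
        exact Subtype.ext (congrArg P (hG₁P q hq))
      right_inv := fun q => Subtype.ext (hG₁P q q.2)
      continuous_toFun := by
        refine Continuous.subtype_mk ?_ _
        rw [continuous_iff_continuousAt]
        rintro ⟨_, q, hq, rfl⟩
        exact ContinuousAt.comp (g := G₁) (hG₁ q hq).continuousAt continuousAt_subtype_val
      continuous_invFun := hP.continuousOn.domRestrict.subtype_mk _ }
  -- The left inverse `G₁` serves as the only chart, so its compatibility conditions are trivial and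
  -- the chart target is `U`.
  have hopen : IsOpenEmbedding (fun x : P '' U => G₁ x) :=
    hU.isOpenEmbedding_subtypeVal.comp h.isOpenEmbedding
  let := hopen.singletonChartedSpace
  have : IsManifold (𝓡 m) ∞ (P '' U) := hopen.isManifold_singleton
  set φ := hopen.toOpenPartialHomeomorph (fun x : P '' U => G₁ x) with hφdef
  have hφ : φ ∈ IsManifold.maximalAtlas (𝓡 m) ∞ (P '' U) :=
    IsManifold.subset_maximalAtlas (mem_singleton _)
  have htarget : φ.target = U := by
    have : φ.target = range (fun x : P '' U => G₁ x) := by simp [hφdef]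
    rw [this]
    ext q
    constructor
    · rintro ⟨x, rfl⟩
      exact (h x).2
    · intro hq
      exact ⟨⟨P q, mem_image_of_mem P hq⟩, hG₁P q hq⟩
  have hPφ : ∀ x : P '' U, (x : E) = P (φ x) := by
    rintro ⟨_, q, hq, rfl⟩
    exact (congrArg P (hG₁P q hq)).symm
  have hQ : ContDiffOn ℝ ∞ (f ∘ P) U := hf.comp_contDiffOn hP
  have hdim : ∀ n, m ≤ n → Module.finrank ℝ (EuclideanSpace ℝ (Fin m)) +
      Module.finrank ℝ (EuclideanSpace ℝ (Fin (n - m))) = n := fun n hn => by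
    simp
    omega
  refine ⟨inferInstance, inferInstance, ⟨?_, IsEmbedding.subtypeVal⟩, ⟨?_, ?_⟩⟩
  · refine (isImmersion_of_injective_fderiv (P := P) (hdim _ hmE) hφ rfl
      (by rwa [htarget]) ?_ hPφ).isImmersion
    rw [htarget]
    exact fun q hq => injective_fderiv_of_leftInverse
      ((hP.contDiffAt (hU.mem_nhds hq)).differentiableAt (by simp)) (hG₁ q hq)
      (Filter.mem_of_superset (hU.mem_nhds hq) hG₁P)
  · refine (isImmersion_of_injective_fderiv (P := f ∘ P) (hdim _ hmF) hφ rfl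
      (by rwa [htarget]) ?_ fun x => congrArg f (hPφ x)).isImmersion
    rw [htarget]
    exact fun q hq => injective_fderiv_of_leftInverse
      ((hQ.contDiffAt (hU.mem_nhds hq)).differentiableAt (by simp)) (hG₂ q hq)
      (Filter.mem_of_superset (hU.mem_nhds hq) hG₂P)
  · have h1 := isEmbedding_restrict_of_leftInverse hQ.continuousOn
      (fun q hq => (hG₂ q hq).continuousAt) hG₂P
    have h2 : (fun x : P '' U => f x) = (fun q : U => (f ∘ P) q) ∘ h :=
      funext fun x => congrArg f (hPφ x)
    rw [h2]
    exact h1.comp h.isEmbedding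

/-! ### Stereographic coordinates on rays. -/

/-- Stereographic projection of the space of rays from the origin: a smooth parametrization `ψ` of
the rays other than the one through `e` and a smooth left inverse `κ` of it that is constant on
rays. -/
theorem exists_stereographic_rays {E : Type*} [NormedAddCommGroup E] [NormedSpace ℝ E]
    [FiniteDimensional ℝ E] {m : ℕ} (hm : Module.finrank ℝ E = m + 1) {e : E} (he : e ≠ 0) :
    ∃ (ψ : EuclideanSpace ℝ (Fin m) → E) (κ : E → EuclideanSpace ℝ (Fin m)),
      ContDiff ℝ ∞ ψ ∧ (∀ p, ψ p ≠ 0) ∧ (∀ p, κ (ψ p) = p) ∧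
      (∀ (c : ℝ) (o : E), 0 < c → κ (c • o) = κ o) ∧
      ∀ o : E, (∀ c : ℝ, 0 ≤ c → o ≠ c • e) →
        DifferentiableAt ℝ κ o ∧ ∃ c : ℝ, 0 < c ∧ ψ (κ o) = c • o := by
  obtain ⟨T₀⟩ : Nonempty (E ≃L[ℝ] ℝ × EuclideanSpace ℝ (Fin m)) :=
    ⟨ContinuousLinearEquiv.ofFinrankEq (by simp [hm, add_comm])⟩
  obtain ⟨T, hT⟩ : ∃ T : E ≃L[ℝ] ℝ × EuclideanSpace ℝ (Fin m), T e = (1, 0) := by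
    obtain ⟨A, hA⟩ := SeparatingDual.exists_continuousLinearEquiv_apply_eq (R := ℝ)
      (x := T₀ e) (y := ((1, 0) : ℝ × EuclideanSpace ℝ (Fin m)))
      (by simpa using he) (by simp)
    exact ⟨T₀.trans A, hA⟩
  -- `κ₀` is stereographic projection from the pole `(1, 0)`, extended to be constant on rays. `ψ₀`
  -- is its usual inverse multiplied by `‖p‖ ^ 2 + 1`, a positive factor that clears denominators
  -- without changing the ray.
  set κ₀ : ℝ × EuclideanSpace ℝ (Fin m) → EuclideanSpace ℝ (Fin m) :=
    fun w => (√(w.1 ^ 2 + ‖w.2‖ ^ 2) - w.1)⁻¹ • w.2 with hκ₀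
  set ψ₀ : EuclideanSpace ℝ (Fin m) → ℝ × EuclideanSpace ℝ (Fin m) :=
    fun p => (‖p‖ ^ 2 - 1, (2 : ℝ) • p) with hψ₀
  refine ⟨fun p => T.symm (ψ₀ p), fun o => κ₀ (T o), ?_, ?_, ?_, ?_, ?_⟩
  · exact T.symm.contDiff.comp (((contDiff_norm_sq ℝ).sub contDiff_const).prodMk
      (contDiff_id.const_smul (2 : ℝ)))
  · intro p hp
    have hp : ψ₀ p = 0 := by simpa using hp
    obtain ⟨h1, h2⟩ := Prod.ext_iff.1 hp
    have h2 : p = 0 := by simpa [hψ₀] using h2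
    simp [hψ₀, h2] at h1
  · intro p
    have h1 : (‖p‖ ^ 2 - 1) ^ 2 + ‖(2 : ℝ) • p‖ ^ 2 = (‖p‖ ^ 2 + 1) ^ 2 := by
      rw [norm_smul]
      norm_num
      ring
    simp only [ContinuousLinearEquiv.apply_symm_apply, hκ₀, hψ₀, h1]
    rw [Real.sqrt_sq (by positivity), smul_smul]
    norm_num
  · intro c o hc
    have h1 : (c * (T o).1) ^ 2 + ‖c • (T o).2‖ ^ 2 = c ^ 2 * ((T o).1 ^ 2 + ‖(T o).2‖ ^ 2) := by
      rw [norm_smul, Real.norm_eq_abs, mul_pow, mul_pow, sq_abs]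
      ring
    simp only [map_smul, hκ₀, Prod.smul_fst, Prod.smul_snd, smul_eq_mul, h1]
    rw [Real.sqrt_mul (sq_nonneg c), Real.sqrt_sq hc.le, ← mul_sub, smul_smul, mul_inv,
      mul_right_comm, inv_mul_cancel₀ hc.ne', one_mul]
  · intro o ho
    obtain ⟨⟨s, h⟩, rfl⟩ := T.symm.surjective o
    set r := √(s ^ 2 + ‖h‖ ^ 2) with hr
    have hr2 : r ^ 2 = s ^ 2 + ‖h‖ ^ 2 := Real.sq_sqrt (by positivity)
    have hsr : s ≤ r := Real.le_sqrt_of_sq_le (by nlinarith [sq_nonneg ‖h‖])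
    have hlt : 0 < r - s := by
      rcases hsr.eq_or_lt with heq | hlt
      · exfalso
        have hs : 0 ≤ s := heq ▸ Real.sqrt_nonneg _
        have hh : ‖h‖ ^ 2 = 0 := by rw [← heq] at hr2; linarith
        have hh : h = 0 := by simpa using hh
        refine ho s hs ?_
        rw [T.symm_apply_eq, map_smul, hT, hh]
        simp
      · linarith
    have hpos : s ^ 2 + ‖h‖ ^ 2 ≠ 0 := by
      intro h0
      rw [h0] at hr2
      have hr0 : r = 0 := by simpa using hr2
      have : s ^ 2 = 0 := by nlinarith [sq_nonneg s, sq_nonneg ‖h‖]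
      have : s = 0 := by simpa using this
      linarith
    constructor
    · have hd : DifferentiableAt ℝ κ₀ (T (T.symm (s, h))) := by
        rw [T.apply_symm_apply]
        have h1 : DifferentiableAt ℝ (fun w : ℝ × EuclideanSpace ℝ (Fin m) =>
            w.1 ^ 2 + ‖w.2‖ ^ 2) (s, h) :=
          (differentiableAt_fst.pow 2).add (differentiableAt_snd.norm_sq ℝ)
        exact (((h1.sqrt hpos).sub differentiableAt_fst).inv hlt.ne').smul differentiableAt_snd
      exact hd.comp _ T.differentiableAt
    · refine ⟨2 / (r - s), by positivity, ?_⟩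
      rw [← map_smul]
      simp only [ContinuousLinearEquiv.apply_symm_apply, hκ₀, hψ₀, ← hr]
      refine congrArg T.symm (Prod.ext ?_ ?_)
      · have h1 : ‖(r - s)⁻¹ • h‖ ^ 2 = (r + s) / (r - s) := by
          rw [norm_smul, Real.norm_eq_abs, mul_pow, sq_abs]
          have : ‖h‖ ^ 2 = (r - s) * (r + s) := by linear_combination -hr2
          rw [this]
          field_simp
        simp only [h1, Prod.smul_fst, smul_eq_mul]
        field_simp
        ring
      · simp only [Prod.smul_snd, smul_smul]
        congr 1

/-! ### Topology and null sets of the join. -/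

namespace TopJoin

section

variable {X Y : Type*}

/-- The join parameter. -/
def param : TopJoin X Y → unitInterval :=
  Quot.lift (fun p => p.2.2) (by rintro _ _ (_ | _) <;> rfl)

@[simp]
theorem param_mk (p : X × Y × unitInterval) : param (mk p) = p.2.2 := rfl

theorem mk_surjective : Function.Surjective (mk : X × Y × unitInterval → TopJoin X Y) :=
  Quot.mk_surjective

variable (X Y) in
/-- The two ends of the join. -/
def ends : Set (TopJoin X Y) := param ⁻¹' {0, 1}

theorem mk_notMem_ends {x : X} {y : Y} {t : unitInterval} :
    mk (x, y, t) ∉ ends X Y ↔ 0 < t ∧ t < 1 := by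
  rw [unitInterval.pos_iff_ne_zero, unitInterval.lt_one_iff_ne_one]
  simp [ends]

variable [TopologicalSpace X] [TopologicalSpace Y]

theorem isQuotientMap_mk : IsQuotientMap (mk : X × Y × unitInterval → TopJoin X Y) :=
  isQuotientMap_quot_mk

theorem continuous_param : Continuous (param : TopJoin X Y → unitInterval) :=
  isQuotientMap_mk.continuous_iff.2 (continuous_snd.comp continuous_snd)

theorem isClosed_ends : IsClosed (ends X Y) :=
  (Set.toFinite _).isClosed.preimage continuous_param

instance [CompactSpace X] [CompactSpace Y] : CompactSpace (TopJoin X Y) :=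
  inferInstanceAs (CompactSpace (Quot (JoinRel X Y)))

end

theorem continuous_toSpace {W : Type*} [AddCommGroup W] [Module ℝ W] [TopologicalSpace W]
    [ContinuousAdd W] [ContinuousSMul ℝ W] (A B : Set W) : Continuous (toSpace A B) := by
  refine isQuotientMap_mk.continuous_iff.2 ?_
  show Continuous fun p : A × B × unitInterval =>
    (p.2.2 : ℝ) • (p.1 : W) + (1 - (p.2.2 : ℝ)) • (p.2.1 : W)
  fun_prop

/-- The ends of the join of two sets that are covered by finitely many smooth images of Euclidean
spaces have small Hausdorff dimension. -/
theorem isNull_ends {W : Type*} [NormedAddCommGroup W] [NormedSpace ℝ W]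
    [FiniteDimensional ℝ W] {A B : Set W}
    [MeasurableSpace (A × B × unitInterval)] [BorelSpace (A × B × unitInterval)] {ι : Type*}
    [Finite ι] {k : ℕ} {QA QB : ι → EuclideanSpace ℝ (Fin k) → W} (hQA : ∀ i, ContDiff ℝ 1 (QA i))
    (hQB : ∀ i, ContDiff ℝ 1 (QB i)) (hA : A ⊆ ⋃ i, range (QA i)) (hB : B ⊆ ⋃ i, range (QB i))
    {d : ℝ} (hd : 2 * (k : ℝ) < d) : IsNull d (ends A B) := by
  have hd0 : 0 ≤ d := le_trans (by positivity) hd.le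
  lift d to NNReal using hd0
  apply hausdorffMeasure_of_dimH_lt
  let F : A × B × unitInterval → W × W × ℝ := fun p => (p.1, p.2.1, p.2.2)
  have hF : Isometry F := isometry_subtype_coe.prodMap
    (isometry_subtype_coe.prodMap isometry_subtype_coe)
  rw [← hF.dimH_image]
  -- At the ends the parameter takes only two values, recorded by the `Bool`, so finitely many
  -- smooth images of a `2 * k`-dimensional space cover them.
  let R : ι × ι × Bool → EuclideanSpace ℝ (Fin k) × EuclideanSpace ℝ (Fin k) → W × W × ℝ :=
    fun i z => (QA i.1 z.1, QB i.2.1 z.2, if i.2.2 then 1 else 0)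
  have hR : ∀ i, ContDiff ℝ 1 (R i) := fun i =>
    ((hQA _).comp contDiff_fst).prodMk (((hQB _).comp contDiff_snd).prodMk contDiff_const)
  have hsub : F '' (mk ⁻¹' ends A B) ⊆ ⋃ i, range (R i) := by
    rintro _ ⟨⟨x, y, t⟩, ht, rfl⟩
    obtain ⟨i, z, hz⟩ := mem_iUnion.1 (hA x.2)
    obtain ⟨j, z', hz'⟩ := mem_iUnion.1 (hB y.2)
    have ht : t = 0 ∨ t = 1 := ht
    rcases ht with rfl | rfl
    · exact mem_iUnion.2 ⟨(i, j, false), (z, z'), by simp [R, F, hz, hz']⟩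
    · exact mem_iUnion.2 ⟨(i, j, true), (z, z'), by simp [R, F, hz, hz']⟩
  have h1 : dimH (F '' (mk ⁻¹' ends A B)) ≤ ((2 * k : ℕ) : ENNReal) := by
    refine (dimH_mono hsub).trans ?_
    rw [dimH_iUnion]
    refine iSup_le fun i => ((hR i).dimH_range_le).trans ?_
    simp [two_mul]
  refine h1.trans_lt ?_
  rw [← ENNReal.coe_natCast, ENNReal.coe_lt_coe, ← NNReal.coe_lt_coe]
  push_cast
  exact hd

end TopJoin

/-! ### The join of `K⁺` and `K⁻`. -/

namespace IsSmoothBody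

variable {V : Type*} [NormedAddCommGroup V] [NormedSpace ℝ V] {K : Set V}

theorem join_eq_sumDiffMap [CompleteSpace V] (hK : IsSmoothBody K) {x y : V × StrongDual ℝ V}
    (hx : x ∈ plusPart K) (hy : y ∈ minusPart K) (t : ℝ) :
    t • x + (1 - t) • y = sumDiffMap K (t • x.1, (1 - t) • y.1) := by
  have h1 := (hK.mem_plusPart_iff.1 hx).2
  have h2 := (hK.mem_minusPart_iff.1 hy).2
  refine Prod.ext rfl ?_
  simp only [Prod.snd_add, Prod.smul_snd, sumDiffMap, hK.dualityMap_smul, h1, h2, smul_neg]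
  exact (sub_eq_add_neg _ _).symm

theorem ext_plusPart [CompleteSpace V] (hK : IsSmoothBody K) {x x' : V × StrongDual ℝ V}
    (hx : x ∈ plusPart K) (hx' : x' ∈ plusPart K) (h : x.1 = x'.1) : x = x' :=
  Prod.ext h (by rw [(hK.mem_plusPart_iff.1 hx).2, (hK.mem_plusPart_iff.1 hx').2, h])

theorem ext_minusPart [CompleteSpace V] (hK : IsSmoothBody K) {x x' : V × StrongDual ℝ V}
    (hx : x ∈ minusPart K) (hx' : x' ∈ minusPart K) (h : x.1 = x'.1) : x = x' :=
  Prod.ext h (by rw [(hK.mem_minusPart_iff.1 hx).2, (hK.mem_minusPart_iff.1 hx').2, h])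

/-- The point of `K⁺` over the direction of a nonzero vector. -/
noncomputable def _root_.plusPoint (K : Set V) (u : V) : V × StrongDual ℝ V :=
  ((gauge K u)⁻¹ • u, dualityMap K ((gauge K u)⁻¹ • u))

/-- The point of `K⁻` over the direction of a nonzero vector. -/
noncomputable def _root_.minusPoint (K : Set V) (u : V) : V × StrongDual ℝ V :=
  ((gauge K u)⁻¹ • u, -dualityMap K ((gauge K u)⁻¹ • u))

section

variable [CompleteSpace V]

theorem plusPoint_mem (hK : IsSmoothBody K) {u : V} (hu : u ≠ 0) : plusPoint K u ∈ plusPart K :=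
  hK.mem_plusPart_iff.2 ⟨hK.gauge_inv_smul_self hu, rfl⟩

theorem minusPoint_mem (hK : IsSmoothBody K) {u : V} (hu : u ≠ 0) :
    minusPoint K u ∈ minusPart K :=
  hK.mem_minusPart_iff.2 ⟨hK.gauge_inv_smul_self hu, rfl⟩

theorem contDiffAt_normalize (hK : IsSmoothBody K) {u : V} (hu : u ≠ 0) :
    ContDiffAt ℝ ∞ (fun u => (gauge K u)⁻¹ • u) u :=
  ((hK.contDiffAt_gauge hu).inv (hK.gauge_pos hu).ne').smul contDiffAt_id

omit [CompleteSpace V] in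
theorem normalize_ne_zero (hK : IsSmoothBody K) {u : V} (hu : u ≠ 0) :
    (gauge K u)⁻¹ • u ≠ 0 :=
  smul_ne_zero (inv_ne_zero (hK.gauge_pos hu).ne') hu

theorem contDiffAt_plusPoint (hK : IsSmoothBody K) {u : V} (hu : u ≠ 0) :
    ContDiffAt ℝ ∞ (plusPoint K) u :=
  (hK.contDiffAt_normalize hu).prodMk
    (ContDiffAt.comp (g := dualityMap K) (f := fun u => (gauge K u)⁻¹ • u) u
      (hK.contDiffAt_dualityMap (hK.normalize_ne_zero hu)) (hK.contDiffAt_normalize hu))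

theorem contDiffAt_minusPoint (hK : IsSmoothBody K) {u : V} (hu : u ≠ 0) :
    ContDiffAt ℝ ∞ (minusPoint K) u :=
  (hK.contDiffAt_normalize hu).prodMk
    (ContDiffAt.comp (g := dualityMap K) (f := fun u => (gauge K u)⁻¹ • u) u
      (hK.contDiffAt_dualityMap (hK.normalize_ne_zero hu)) (hK.contDiffAt_normalize hu)).neg

omit [CompleteSpace V] in
theorem normalize_smul (hK : IsSmoothBody K) {c : ℝ} (hc : 0 < c) {x : V} (hx : gauge K x = 1) :
    (gauge K (c • x))⁻¹ • c • x = x := by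
  rw [hK.gauge_smul, hx, mul_one, abs_of_pos hc, inv_smul_smul₀ hc.ne']

theorem plusPoint_smul (hK : IsSmoothBody K) {c : ℝ} (hc : 0 < c) {x : V × StrongDual ℝ V}
    (hx : x ∈ plusPart K) : plusPoint K (c • x.1) = x := by
  have h := hK.mem_plusPart_iff.1 hx
  have hne : x.1 ≠ 0 := fun h0 => by simp [h0] at h
  exact hK.ext_plusPart (hK.plusPoint_mem (smul_ne_zero hc.ne' hne)) hx (hK.normalize_smul hc h.1)

theorem minusPoint_smul (hK : IsSmoothBody K) {c : ℝ} (hc : 0 < c) {x : V × StrongDual ℝ V}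
    (hx : x ∈ minusPart K) : minusPoint K (c • x.1) = x := by
  have h := hK.mem_minusPart_iff.1 hx
  have hne : x.1 ≠ 0 := fun h0 => by simp [h0] at h
  exact hK.ext_minusPart (hK.minusPoint_mem (smul_ne_zero hc.ne' hne)) hx
    (hK.normalize_smul hc h.1)

end

variable [FiniteDimensional ℝ V]

theorem isNull_ends [MeasurableSpace V] [BorelSpace V] (hK : IsSmoothBody K) :
    TopJoin.IsNull (2 * (Module.finrank ℝ V : ℝ) - 1)
      (TopJoin.ends (plusPart K) (minusPart K)) := by
  rcases subsingleton_or_nontrivial V with hV | hV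
  · have : IsEmpty (plusPart K) := ⟨fun x => by
      have := (hK.mem_plusPart_iff.1 x.2).1
      rw [Subsingleton.elim (x : V × StrongDual ℝ V).1 0, gauge_zero] at this
      exact zero_ne_one this⟩
    rw [TopJoin.IsNull, Set.eq_empty_of_isEmpty (TopJoin.mk ⁻¹' _), measure_empty]
  obtain ⟨k, hk⟩ : ∃ k, Module.finrank ℝ V = k + 1 :=
    Nat.exists_eq_succ_of_ne_zero Module.finrank_pos.ne'
  obtain ⟨e, he⟩ := exists_ne (0 : V)
  -- Two stereographic charts with opposite poles reach every direction. Each factor has dimension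
  -- `k = n - 1`, so the ends have dimension at most `2 * n - 2`.
  obtain ⟨ψ₁, κ₁, hψ₁, hψ₁0, -, -, h₁⟩ := exists_stereographic_rays hk he
  obtain ⟨ψ₂, κ₂, hψ₂, hψ₂0, -, -, h₂⟩ := exists_stereographic_rays hk (neg_ne_zero.2 he)
  let ψ : Bool → EuclideanSpace ℝ (Fin k) → V := fun i => if i then ψ₁ else ψ₂
  have hψ : ∀ i, ContDiff ℝ ∞ (ψ i) := by rintro (_ | _) <;> assumption
  have hψ0 : ∀ i p, ψ i p ≠ 0 := by rintro (_ | _) <;> assumption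
  have hcover : ∀ x : V, x ≠ 0 → ∃ i p, ∃ c : ℝ, 0 < c ∧ ψ i p = c • x := by
    intro x hx
    by_cases h : ∀ c : ℝ, 0 ≤ c → x ≠ c • e
    · obtain ⟨-, c, hc, hc'⟩ := h₁ x h
      exact ⟨true, _, c, hc, hc'⟩
    · push Not at h
      obtain ⟨c, hc, hxc⟩ := h
      obtain ⟨-, c', hc', hc''⟩ := h₂ x (fun c' hc' hx' => by
        have h0 : (c + c') • e = 0 := by
          rw [add_smul, ← hxc, hx', smul_neg, neg_add_cancel]
        have : c + c' = 0 := (smul_eq_zero.1 h0).resolve_right he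
        have : c = 0 := by linarith
        exact hx (by rw [hxc, this, zero_smul]))
      exact ⟨false, _, c', hc', hc''⟩
  refine TopJoin.isNull_ends (QA := fun i p => plusPoint K (ψ i p))
    (QB := fun i p => minusPoint K (ψ i p)) (fun i => ?_) (fun i => ?_) ?_ ?_ ?_ (k := k)
  · exact contDiff_iff_contDiffAt.2 fun p => ((hK.contDiffAt_plusPoint (hψ0 i p)).comp p
      (hψ i).contDiffAt).of_le (by exact_mod_cast le_top)
  · exact contDiff_iff_contDiffAt.2 fun p => ((hK.contDiffAt_minusPoint (hψ0 i p)).comp p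
      (hψ i).contDiffAt).of_le (by exact_mod_cast le_top)
  · intro x hx
    have h := hK.mem_plusPart_iff.1 hx
    obtain ⟨i, p, c, hc, hp⟩ := hcover x.1 (fun h0 => by simp [h0] at h)
    exact mem_iUnion.2 ⟨i, p, by simp only [hp, hK.plusPoint_smul hc hx]⟩
  · intro x hx
    have h := hK.mem_minusPart_iff.1 hx
    obtain ⟨i, p, c, hc, hp⟩ := hcover x.1 (fun h0 => by simp [h0] at h)
    exact mem_iUnion.2 ⟨i, p, by simp only [hp, hK.minusPoint_smul hc hx]⟩
  · rw [hk]
    push_cast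
    linarith

/-- Injectivity of `sumDiffMap` recovers `t x.1` and `(1 - t) y.1`. The gauge of the first is `t`,
and `x` or `y` is lost exactly where the join collapses it. -/
theorem toSpace_injective (hK : IsSmoothBody K) (hP : IsSmoothBody (StrongDual.polar ℝ K)) :
    Function.Injective (TopJoin.toSpace (plusPart K) (minusPart K)) := by
  intro p q hpq
  obtain ⟨⟨x, y, t⟩, rfl⟩ := TopJoin.mk_surjective p
  obtain ⟨⟨x', y', t'⟩, rfl⟩ := TopJoin.mk_surjective q
  have h : (t : ℝ) • (x : V × StrongDual ℝ V) + (1 - (t : ℝ)) • (y : V × StrongDual ℝ V) =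
    (t' : ℝ) • (x' : V × StrongDual ℝ V) + (1 - (t' : ℝ)) • (y' : V × StrongDual ℝ V) := hpq
  rw [hK.join_eq_sumDiffMap x.2 y.2, hK.join_eq_sumDiffMap x'.2 y'.2] at h
  obtain ⟨h1, h2⟩ := Prod.ext_iff.1 (hK.sumDiffMap_injective hP h)
  simp only at h1 h2
  have ht : t = t' := by
    have := congrArg (gauge K) h1
    rw [hK.gauge_smul, hK.gauge_smul, (hK.mem_plusPart_iff.1 x.2).1,
      (hK.mem_plusPart_iff.1 x'.2).1, abs_of_nonneg t.2.1, abs_of_nonneg t'.2.1, mul_one,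
      mul_one] at this
    exact Subtype.ext this
  subst ht
  have hx : (t : ℝ) ≠ 0 → x = x' := fun h0 =>
    Subtype.ext (hK.ext_plusPart x.2 x'.2 (smul_right_injective V h0 h1))
  have hy : (1 - (t : ℝ)) ≠ 0 → y = y' := fun h0 =>
    Subtype.ext (hK.ext_minusPart y.2 y'.2 (smul_right_injective V h0 h2))
  by_cases h0 : t = 0
  · subst h0
    rw [hy (by simp)]
    exact Quot.sound (JoinRel.zero x x' y')
  by_cases h1' : t = 1
  · subst h1'
    rw [hx (by simp)]
    exact Quot.sound (JoinRel.one x' y y')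
  rw [hx (fun h => h0 (Subtype.ext h)), hy (fun h => h1' (Subtype.ext (by simpa using
    (sub_eq_zero.1 h).symm)))]

theorem isCompact_plusPart (hK : IsSmoothBody K) : IsCompact (plusPart K) := by
  have hc : IsCompact (K ×ˢ StrongDual.polar ℝ K) :=
    (Metric.isCompact_of_isClosed_isBounded hK.isClosed hK.isBounded).prod
      (Metric.isCompact_of_isClosed_isBounded (NormedSpace.isClosed_polar ℝ K)
        (NormedSpace.isBounded_polar_of_mem_nhds_zero ℝ hK.mem_nhds))
  have hcl : IsClosed {w : V × StrongDual ℝ V | w.2 w.1 = 1} :=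
    isClosed_eq (continuous_snd.clm_apply continuous_fst) continuous_const
  convert hc.inter_right hcl using 1
  ext w
  simp [plusPart, and_assoc]

theorem isCompact_minusPart (hK : IsSmoothBody K) : IsCompact (minusPart K) := by
  convert hK.isCompact_plusPart.image (f := fun w => (w.1, -w.2)) (by fun_prop) using 1
  ext w
  rw [mem_minusPart_iff_mem_plusPart]
  constructor
  · exact fun h => ⟨_, h, by simp⟩
  · rintro ⟨w, hw, rfl⟩
    simpa using hw

theorem isClosedEmbedding_toSpace (hK : IsSmoothBody K)
    (hP : IsSmoothBody (StrongDual.polar ℝ K)) :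
    IsClosedEmbedding (TopJoin.toSpace (plusPart K) (minusPart K)) := by
  have := isCompact_iff_compactSpace.1 hK.isCompact_plusPart
  have := isCompact_iff_compactSpace.1 hK.isCompact_minusPart
  exact (TopJoin.continuous_toSpace _ _).isClosedEmbedding (hK.toSpace_injective hP)

theorem existsUnique_smul_mem_range_toSpace (hK : IsSmoothBody K)
    (hP : IsSmoothBody (StrongDual.polar ℝ K)) {w : V × StrongDual ℝ V} (hw : w ≠ 0) :
    ∃! s : ℝ, 0 ≤ s ∧ s • w ∈ range (TopJoin.toSpace (plusPart K) (minusPart K)) := by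
  obtain ⟨⟨u, v⟩, rfl⟩ := hK.sumDiffMap_surjective w
  have huv : u ≠ 0 ∨ v ≠ 0 := by
    by_contra! h
    rw [h.1, h.2] at hw
    exact hw sumDiffMap_zero
  have hpos : 0 < gauge K u + gauge K v := by
    rcases huv with h | h
    · exact add_pos_of_pos_of_nonneg (hK.gauge_pos h) (gauge_nonneg _)
    · exact add_pos_of_nonneg_of_pos (gauge_nonneg _) (hK.gauge_pos h)
  obtain ⟨e, he⟩ : ∃ e : V, e ≠ 0 := huv.elim (fun h => ⟨u, h⟩) fun h => ⟨v, h⟩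
  -- When `u` or `v` vanishes, the corresponding point of `K⁺` or `K⁻` is arbitrary and is taken in
  -- the direction of `e`.
  have hdir : ∀ z : V, ∃ x : V, x ≠ 0 ∧ gauge K z • (gauge K x)⁻¹ • x = z := fun z => by
    by_cases hz : z = 0
    · exact ⟨e, he, by simp [hz]⟩
    · exact ⟨z, hz, smul_inv_smul₀ (hK.gauge_pos hz).ne' _⟩
  -- The range is the image of the pairs whose gauges add up to 1, so homogeneity forces this
  -- scaling factor.
  refine ⟨(gauge K u + gauge K v)⁻¹, ⟨by positivity, ?_⟩, ?_⟩
  · obtain ⟨x, hx, hxu⟩ := hdir u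
    obtain ⟨y, hy, hyv⟩ := hdir v
    have ht : gauge K u / (gauge K u + gauge K v) ∈ unitInterval :=
      ⟨div_nonneg (gauge_nonneg _) hpos.le,
        (div_le_one hpos).2 (le_add_of_nonneg_right (gauge_nonneg _))⟩
    refine ⟨TopJoin.mk (⟨_, hK.plusPoint_mem hx⟩, ⟨_, hK.minusPoint_mem hy⟩, ⟨_, ht⟩), ?_⟩
    refine (hK.join_eq_sumDiffMap (hK.plusPoint_mem hx) (hK.minusPoint_mem hy) _).trans ?_
    rw [← hK.sumDiffMap_smul]
    congr 1
    have h1 : 1 - gauge K u / (gauge K u + gauge K v) =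
      (gauge K u + gauge K v)⁻¹ * gauge K v := by
      field_simp
      ring
    refine Prod.ext ?_ ?_
    · simp only [div_eq_inv_mul, plusPoint, mul_smul, hxu, Prod.smul_fst]
    · simp only [h1, minusPoint, mul_smul, hyv, Prod.smul_snd]
  · rintro s ⟨hs, p, hp⟩
    obtain ⟨⟨x, y, t⟩, rfl⟩ := TopJoin.mk_surjective p
    have h : (t : ℝ) • (x : V × StrongDual ℝ V) + (1 - (t : ℝ)) • (y : V × StrongDual ℝ V) =
      s • sumDiffMap K (u, v) := hp
    rw [hK.join_eq_sumDiffMap x.2 y.2, ← hK.sumDiffMap_smul] at h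
    obtain ⟨h1, h2⟩ := Prod.ext_iff.1 (hK.sumDiffMap_injective hP h)
    have h1 := congrArg (gauge K) h1
    have h2 := congrArg (gauge K) h2
    simp only [Prod.smul_fst, Prod.smul_snd, hK.gauge_smul, (hK.mem_plusPart_iff.1 x.2).1,
      (hK.mem_minusPart_iff.1 y.2).1, abs_of_nonneg hs, abs_of_nonneg t.2.1,
      abs_of_nonneg (sub_nonneg.2 t.2.2), mul_one] at h1 h2
    exact eq_inv_of_mul_eq_one_left (by linarith)

theorem isSmoothEmbeddingOn_smoothPart (hK : IsSmoothBody K)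
    (hP : IsSmoothBody (StrongDual.polar ℝ K)) :
    IsSmoothEmbeddingOn (2 * Module.finrank ℝ V - 1)
      (TopJoin.smoothPart (plusPart K) (minusPart K) (TopJoin.ends _ _))
      (fun p => p.2.2 • p.1 + (1 - p.2.2) • p.2.1) := by
  have hf : ContDiff ℝ ∞ (fun p : (V × StrongDual ℝ V) × (V × StrongDual ℝ V) × ℝ =>
      p.2.2 • p.1 + (1 - p.2.2) • p.2.1) := by fun_prop
  have hdual : Module.finrank ℝ (StrongDual ℝ V) = Module.finrank ℝ V := by
    rw [← (LinearMap.toContinuousLinearMap (𝕜 := ℝ) (E := V) (F' := ℝ)).finrank_eq]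
    exact Subspace.dual_finrank_eq
  have hdimE : 2 * Module.finrank ℝ V - 1 ≤
      Module.finrank ℝ ((V × StrongDual ℝ V) × (V × StrongDual ℝ V) × ℝ) := by
    simp only [Module.finrank_prod, hdual]
    omega
  have hdimF : 2 * Module.finrank ℝ V - 1 ≤ Module.finrank ℝ (V × StrongDual ℝ V) := by
    simp only [Module.finrank_prod, hdual]
    omega
  -- For `V = 0` the truncated dimension `2 * 0 - 1` is 0, not -1; the statement survives because
  -- the manifold is empty.
  rcases subsingleton_or_nontrivial V with hV | hV
  · refine isSmoothEmbeddingOn_of_leftInverse hdimE hdimF hf isOpen_empty (P := 0) (G₁ := 0)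
      (G₂ := 0) (contDiffOn_empty) ?_ (by simp) (by simp) (by simp) (by simp)
    rw [image_empty, eq_comm, eq_empty_iff_forall_notMem]
    rintro p ⟨x, -⟩
    have := (hK.mem_plusPart_iff.1 x.2).1
    rw [Subsingleton.elim (x : V × StrongDual ℝ V).1 0, gauge_zero] at this
    exact zero_ne_one this
  have hn : 0 < Module.finrank ℝ V := Module.finrank_pos
  obtain ⟨e, he⟩ := exists_ne (0 : V)
  -- The pole `(0, e)` has zero first component, so the omitted ray is irrelevant and one chart
  -- covers all rays with both components nonzero.
  obtain ⟨ψ, κ, hψ, -, hκψ, hκ, hψκ⟩ := exists_stereographic_rays (E := V × V)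
    (m := 2 * Module.finrank ℝ V - 1) (by rw [Module.finrank_prod]; omega)
    (e := (0, e)) (by simp [he])
  have hoff : ∀ o : V × V, o.1 ≠ 0 → ∀ c : ℝ, 0 ≤ c → o ≠ c • ((0, e) : V × V) := by
    rintro o ho c - rfl
    simp at ho
  set U : Set (EuclideanSpace ℝ (Fin (2 * Module.finrank ℝ V - 1))) :=
    {p | (ψ p).1 ≠ 0 ∧ (ψ p).2 ≠ 0} with hUdef
  have hU : IsOpen U := by
    have h1 : Continuous ψ := hψ.continuous
    exact (isOpen_ne_fun (continuous_fst.comp h1) continuous_const).inter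
      (isOpen_ne_fun (continuous_snd.comp h1) continuous_const)
  let τ : V × V → ℝ := fun o => gauge K o.1 / (gauge K o.1 + gauge K o.2)
  let P₀ : V × V → (V × StrongDual ℝ V) × (V × StrongDual ℝ V) × ℝ := fun o =>
    (plusPoint K o.1, minusPoint K o.2, τ o)
  have hsum : ∀ o : V × V, o.1 ≠ 0 → o.2 ≠ 0 → 0 < gauge K o.1 + gauge K o.2 :=
    fun o h1 h2 => add_pos (hK.gauge_pos h1) (hK.gauge_pos h2)
  have hτ1 : ∀ o : V × V, o.1 ≠ 0 → o.2 ≠ 0 →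
      τ o • (plusPoint K o.1).1 = (gauge K o.1 + gauge K o.2)⁻¹ • o.1 := fun o h1 h2 => by
    simp only [τ, plusPoint, smul_smul]
    congr 1
    have := hK.gauge_pos h1
    field_simp
  have hτ2 : ∀ o : V × V, o.1 ≠ 0 → o.2 ≠ 0 →
      (1 - τ o) • (minusPoint K o.2).1 = (gauge K o.1 + gauge K o.2)⁻¹ • o.2 := fun o h1 h2 => by
    simp only [τ, minusPoint, smul_smul]
    congr 1
    have := hK.gauge_pos h2
    have := hsum o h1 h2
    field_simp
    ring
  have hP₀ : ∀ o : V × V, o.1 ≠ 0 → o.2 ≠ 0 → ContDiffAt ℝ ∞ P₀ o := by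
    intro o h1 h2
    have g1 : ContDiffAt ℝ ∞ (fun o : V × V => gauge K o.1) o :=
      (hK.contDiffAt_gauge h1).comp o contDiffAt_fst
    have g2 : ContDiffAt ℝ ∞ (fun o : V × V => gauge K o.2) o :=
      (hK.contDiffAt_gauge h2).comp o contDiffAt_snd
    exact ((hK.contDiffAt_plusPoint h1).comp o contDiffAt_fst).prodMk
      (((hK.contDiffAt_minusPoint h2).comp o contDiffAt_snd).prodMk
        (g1.div (g1.add g2) (hsum o h1 h2).ne'))
  have hfP : ∀ o : V × V, o.1 ≠ 0 → o.2 ≠ 0 →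
      (P₀ o).2.2 • (P₀ o).1 + (1 - (P₀ o).2.2) • (P₀ o).2.1 =
        sumDiffMap K ((gauge K o.1 + gauge K o.2)⁻¹ • o) := by
    intro o h1 h2
    rw [hK.join_eq_sumDiffMap (hK.plusPoint_mem h1) (hK.minusPoint_mem h2)]
    exact congrArg (sumDiffMap K) (Prod.ext (hτ1 o h1 h2) (hτ2 o h1 h2))
  have hκsmul : ∀ p ∈ U, κ ((gauge K (ψ p).1 + gauge K (ψ p).2)⁻¹ • ψ p) = p := fun p hp => by
    rw [hκ _ _ (inv_pos.2 (hsum _ hp.1 hp.2)), hκψ]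
  have hne : ∀ p ∈ U, ((gauge K (ψ p).1 + gauge K (ψ p).2)⁻¹ • ψ p).1 ≠ 0 ∧
      ((gauge K (ψ p).1 + gauge K (ψ p).2)⁻¹ • ψ p).2 ≠ 0 := fun p hp =>
    ⟨smul_ne_zero (inv_ne_zero (hsum _ hp.1 hp.2).ne') hp.1,
      smul_ne_zero (inv_ne_zero (hsum _ hp.1 hp.2).ne') hp.2⟩
  -- `B` recovers `(t x.1, (1 - t) y.1)` from a point of the manifold, while `sumDiffInv` recovers
  -- it from the image in `W`. Following either by `κ` gives the two left inverses.
  let B : (V × StrongDual ℝ V) × (V × StrongDual ℝ V) × ℝ → V × V :=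
    fun w => (w.2.2 • w.1.1, (1 - w.2.2) • w.2.1.1)
  have hB : Differentiable ℝ B := by fun_prop
  have hBP : ∀ p ∈ U, B (P₀ (ψ p)) = (gauge K (ψ p).1 + gauge K (ψ p).2)⁻¹ • ψ p :=
    fun p hp => Prod.ext (hτ1 _ hp.1 hp.2) (hτ2 _ hp.1 hp.2)
  refine isSmoothEmbeddingOn_of_leftInverse hdimE hdimF hf hU (P := fun p => P₀ (ψ p))
    (G₁ := fun w => κ (B w)) (G₂ := fun w => κ (sumDiffInv K w)) ?_ ?_ ?_ ?_ ?_ ?_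
  · exact fun p hp => ((hP₀ _ hp.1 hp.2).comp p hψ.contDiffAt).contDiffWithinAt
  · ext w
    constructor
    · rintro ⟨p, hp, rfl⟩
      have hs := hsum _ hp.1 hp.2
      have g1 := hK.gauge_pos hp.1
      have g2 := hK.gauge_pos hp.2
      have ht : τ (ψ p) ∈ unitInterval :=
        ⟨div_nonneg g1.le hs.le, (div_le_one hs).2 (le_add_of_nonneg_right g2.le)⟩
      have ht0 : (0 : unitInterval) < ⟨τ (ψ p), ht⟩ := Subtype.mk_lt_mk.2 (div_pos g1 hs)
      have ht1 : (⟨τ (ψ p), ht⟩ : unitInterval) < 1 :=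
        Subtype.mk_lt_mk.2 ((div_lt_one hs).2 (lt_add_of_pos_right _ g2))
      exact ⟨⟨_, hK.plusPoint_mem hp.1⟩, ⟨_, hK.minusPoint_mem hp.2⟩, ⟨τ (ψ p), ht⟩, ht0, ht1,
        TopJoin.mk_notMem_ends.2 ⟨ht0, ht1⟩, rfl⟩
    · rintro ⟨x, y, t, ht0, ht1, -, rfl⟩
      have ht0 : 0 < (t : ℝ) := ht0
      have ht1 : 0 < 1 - (t : ℝ) := sub_pos.2 ht1
      have hx := hK.mem_plusPart_iff.1 x.2
      have hy := hK.mem_minusPart_iff.1 y.2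
      have hx0 : (x : V × StrongDual ℝ V).1 ≠ 0 := fun h0 => by simp [h0] at hx
      have hy0 : (y : V × StrongDual ℝ V).1 ≠ 0 := fun h0 => by simp [h0] at hy
      set o : V × V := ((t : ℝ) • (x : V × StrongDual ℝ V).1,
        (1 - (t : ℝ)) • (y : V × StrongDual ℝ V).1) with ho
      obtain ⟨-, c, hc, hψo⟩ := hψκ o (hoff o (smul_ne_zero ht0.ne' hx0))
      have e1 : (ψ (κ o)).1 = (c * t) • (x : V × StrongDual ℝ V).1 := by
        rw [hψo, mul_smul, ho]
        rfl
      have e2 : (ψ (κ o)).2 = (c * (1 - t)) • (y : V × StrongDual ℝ V).1 := by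
        rw [hψo, mul_smul, ho]
        rfl
      have c1 : 0 < c * (t : ℝ) := mul_pos hc ht0
      have c2 : 0 < c * (1 - (t : ℝ)) := mul_pos hc ht1
      refine ⟨κ o, ⟨?_, ?_⟩, Prod.ext ?_ (Prod.ext ?_ ?_)⟩
      · rw [e1]
        exact smul_ne_zero c1.ne' hx0
      · rw [e2]
        exact smul_ne_zero c2.ne' hy0
      · show plusPoint K (ψ (κ o)).1 = x
        rw [e1, hK.plusPoint_smul c1 x.2]
      · show minusPoint K (ψ (κ o)).2 = y
        rw [e2, hK.minusPoint_smul c2 y.2]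
      · show gauge K (ψ (κ o)).1 / (gauge K (ψ (κ o)).1 + gauge K (ψ (κ o)).2) = t
        rw [e1, e2, hK.gauge_smul, hK.gauge_smul, hx.1, hy.1, abs_of_pos c1, abs_of_pos c2]
        field_simp
        ring
  · intro p hp
    have h1 : DifferentiableAt ℝ κ (B (P₀ (ψ p))) := by
      rw [hBP p hp]
      exact (hψκ _ (hoff _ (hne p hp).1)).1
    exact h1.comp _ hB.differentiableAt
  · intro p hp
    simp only [hBP p hp, hκsmul p hp]
  · intro p hp
    simp only [hfP _ hp.1 hp.2]
    refine DifferentiableAt.comp (g := κ) _ ?_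
      (hK.differentiableAt_sumDiffInv hP (hne p hp).1 (hne p hp).2)
    rw [hK.sumDiffInv_sumDiffMap hP]
    exact (hψκ _ (hoff _ (hne p hp).1)).1
  · intro p hp
    simp only [hfP _ hp.1 hp.2, hK.sumDiffInv_sumDiffMap hP, hκsmul p hp]

end IsSmoothBody

theorem propositionp {V : Type*} [NormedAddCommGroup V] [NormedSpace ℝ V] [FiniteDimensional ℝ V]
    [MeasurableSpace V] [BorelSpace V]
    (K : ConvexBody V) (hsymm : ∀ x ∈ K, -x ∈ K) (hint : (interior (K : Set V)).Nonempty)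
    (hK : HasSmoothBoundary (K : Set V))
    (hK' : HasSmoothBoundary (StrongDual.polar ℝ (K : Set V))) :
    (∃ N : Set (TopJoin (plusPart (K : Set V)) (minusPart (K : Set V))),
      IsClosed N ∧
      TopJoin.IsNull (2 * (Module.finrank ℝ V : ℝ) - 1) N ∧
      (∀ x y t, t = 0 ∨ t = 1 → TopJoin.mk (x, y, t) ∈ N) ∧
      IsEmbedding
        (fun p : (Nᶜ : Set _) =>
          TopJoin.toSpace (plusPart (K : Set V)) (minusPart (K : Set V)) p) ∧
      IsSmoothEmbeddingOn (2 * Module.finrank ℝ V - 1)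
        (TopJoin.smoothPart (plusPart (K : Set V)) (minusPart (K : Set V)) N)
        (fun p => p.2.2 • p.1 + (1 - p.2.2) • p.2.1)) ∧
    (∀ (μ : Measure (V × StrongDual ℝ V)) [μ.IsAddHaarMeasure],
      ∀ᵐ w ∂μ, w ≠ 0 → ∃! s : ℝ, 0 ≤ s ∧
        s • w ∈ range (TopJoin.toSpace (plusPart (K : Set V)) (minusPart (K : Set V)))) := by
  have hbody : IsSmoothBody (K : Set V) :=
    { convex := K.convex
      isClosed := K.isClosed
      isBounded := K.isBounded
      mem_nhds := by
        obtain ⟨x, hx⟩ := hint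
        -- The origin is the midpoint of an interior point and its negative.
        have hx' : -x ∈ (K : Set V) := hsymm x (interior_subset hx)
        have := K.convex.combo_interior_self_mem_interior hx hx' (a := 1 / 2) (b := 1 / 2)
          (by norm_num) (by norm_num) (by norm_num)
        rw [smul_neg, add_neg_cancel] at this
        exact mem_interior_iff_mem_nhds.1 this
      neg_mem := hsymm
      smooth := hK }
  have hpolar := hbody.polar hK'
  refine ⟨⟨TopJoin.ends _ _, TopJoin.isClosed_ends, hbody.isNull_ends, fun x y t ht => ht,
    (hbody.isClosedEmbedding_toSpace hpolar).isEmbedding.comp IsEmbedding.subtypeVal,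
    hbody.isSmoothEmbeddingOn_smoothPart hpolar⟩, ?_⟩
  -- The ray property holds for every nonzero `w`, with no exceptional null set.
  exact fun μ _ => Filter.Eventually.of_forall fun w hw =>
    hbody.existsUnique_smul_mem_range_toSpace hpolar hw
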